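/- Let $A$ be a smooth, finitely generated, commutative algebra over $\mathbf{C}$ and let $d\ge 0$. Let $P(A)$ be the Poisson envelope of $A$, i.e. the value at $A$ of the left adjoint of the functor from Poisson algebras over $\mathbf{C}$ to commutative algebras over $\mathbf{C}$ which forgets the Poisson bracket, and let $P^d(A)\subset P(A)$ be the $A$-submodule spanned by all formal expressions in elements of $A$, built by products and Poisson brackets, which contain exactly $d$ brackets. For an $A$-module $M$ let $\mathrm{Lie}_A(M)=\bigoplus_{n\ge 1}\mathrm{Lie}_A^n(M)$ be the free Lie algebra over $A$ generated by the module $M$, put $\mathrm{Lie}_{A,\ge 2}(M)=\bigoplus_{n\ge 2}\mathrm{Lie}_A^n(M)$ with $\mathrm{Lie}_A^n(M)$ placed in degree $n-1$, and let $Q_A^d(M)=S_A(\mathrm{Lie}_{A,\ge 2}(M))^d$ be the degree $d$ part of its symmetric algebra over $A$ for the induced grading. Then $P^d(A)$ is isomorphic to $Q_A^d(\Omega^1_A)$ as an $A$-module, where $\Omega^1_A$ is the module of Kähler differentials of $A$ over $\mathbf{C}$. -/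

import Mathlib

noncomputable section

/-! ### Poisson algebras and the Poisson envelope -/

/-- A Poisson bracket on a commutative `R`-algebra `P`: an `R`-bilinear alternating operation
which satisfies the Jacobi identity and is a derivation in each argument (the derivation property
in the first argument follows by antisymmetry). -/
structure PoissonBracket (R P : Type*) [CommRing R] [CommRing P] [Algebra R P] where
  /-- The bracket. -/
  bracket : P →ₗ[R] P →ₗ[R] P
  bracket_self : ∀ x, bracket x x = 0
  jacobi : ∀ x y z, bracket x (bracket y z) = bracket (bracket x y) z + bracket y (bracket x z)
  leibniz : ∀ x y z, bracket x (y * z) = bracket x y * z + y * bracket x z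

/-- Formal expressions in elements of `A`, with formal sums, products and Poisson brackets. -/
inductive PoissonExpr (A : Type*) : Type _
  | of (a : A) : PoissonExpr A
  | add (x y : PoissonExpr A) : PoissonExpr A
  | mul (x y : PoissonExpr A) : PoissonExpr A
  | bracket (x y : PoissonExpr A) : PoissonExpr A

/-- The relations between formal expressions which hold in every Poisson `R`-algebra that receives
a homomorphism of commutative `R`-algebras from `A`. -/
inductive PoissonExpr.Rel (R : Type*) {A : Type*} [CommRing R] [CommRing A] [Algebra R A] :
    PoissonExpr A → PoissonExpr A → Prop
  -- compatibility with the operations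
  | congr_add_left {x x'} (y) : Rel R x x' → Rel R (add x y) (add x' y)
  | congr_add_right (x) {y y'} : Rel R y y' → Rel R (add x y) (add x y')
  | congr_mul_left {x x'} (y) : Rel R x x' → Rel R (mul x y) (mul x' y)
  | congr_mul_right (x) {y y'} : Rel R y y' → Rel R (mul x y) (mul x y')
  | congr_bracket_left {x x'} (y) : Rel R x x' → Rel R (bracket x y) (bracket x' y)
  | congr_bracket_right (x) {y y'} : Rel R y y' → Rel R (bracket x y) (bracket x y')
  -- commutative ring axioms
  | add_comm (x y) : Rel R (add x y) (add y x)
  | add_assoc (x y z) : Rel R (add (add x y) z) (add x (add y z))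
  | zero_add (x) : Rel R (add (of 0) x) x
  | mul_comm (x y) : Rel R (mul x y) (mul y x)
  | mul_assoc (x y z) : Rel R (mul (mul x y) z) (mul x (mul y z))
  | one_mul (x) : Rel R (mul (of 1) x) x
  | zero_mul (x) : Rel R (mul (of 0) x) (of 0)
  | mul_add (x y z) : Rel R (mul x (add y z)) (add (mul x y) (mul x z))
  -- `of` is additive and multiplicative
  | of_add (a b : A) : Rel R (of (a + b)) (add (of a) (of b))
  | of_mul (a b : A) : Rel R (of (a * b)) (mul (of a) (of b))
  -- Poisson bracket axioms
  | add_bracket (x y z) : Rel R (bracket (add x y) z) (add (bracket x z) (bracket y z))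
  | bracket_add (x y z) : Rel R (bracket x (add y z)) (add (bracket x y) (bracket x z))
  | smul_bracket (r : R) (x y) :
      Rel R (bracket (mul (of (algebraMap R A r)) x) y)
        (mul (of (algebraMap R A r)) (bracket x y))
  | bracket_smul (r : R) (x y) :
      Rel R (bracket x (mul (of (algebraMap R A r)) y))
        (mul (of (algebraMap R A r)) (bracket x y))
  | bracket_self (x) : Rel R (bracket x x) (of 0)
  | jacobi (x y z) :
      Rel R (bracket x (bracket y z)) (add (bracket (bracket x y) z) (bracket y (bracket x z)))
  | leibniz (x y z) :
      Rel R (bracket x (mul y z)) (add (mul (bracket x y) z) (mul y (bracket x z)))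

/-- The Poisson envelope `P(A)` of a commutative `R`-algebra `A`: the Poisson `R`-algebra generated
by the elements of `A` subject to the relations of the commutative `R`-algebra `A`. -/
def PoissonEnvelope (R A : Type*) [CommRing R] [CommRing A] [Algebra R A] : Type _ :=
  Quot (PoissonExpr.Rel R (A := A))

namespace PoissonEnvelope

open PoissonExpr

variable (R : Type*) {A : Type*} [CommRing R] [CommRing A] [Algebra R A]

/-- The element of `P(A)` given by a formal expression. -/
def mk (x : PoissonExpr A) : PoissonEnvelope R A := Quot.mk _ x

variable {R} in
theorem sound {x y : PoissonExpr A} (h : PoissonExpr.Rel R x y) : mk R x = mk R y := Quot.sound h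

instance : Zero (PoissonEnvelope R A) := ⟨mk R (of 0)⟩
instance : One (PoissonEnvelope R A) := ⟨mk R (of 1)⟩
instance : Add (PoissonEnvelope R A) :=
  ⟨Quot.map₂ add (fun x _ _ h => .congr_add_right x h) (fun _ _ y h => .congr_add_left y h)⟩
instance : Mul (PoissonEnvelope R A) :=
  ⟨Quot.map₂ mul (fun x _ _ h => .congr_mul_right x h) (fun _ _ y h => .congr_mul_left y h)⟩
instance : Neg (PoissonEnvelope R A) := ⟨fun x => mk R (of (-1)) * x⟩

instance : CommRing (PoissonEnvelope R A) where
  add_assoc := by rintro ⟨x⟩ ⟨y⟩ ⟨z⟩; exact Quot.sound (.add_assoc x y z)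
  zero_add := by rintro ⟨x⟩; exact Quot.sound (.zero_add x)
  add_zero := by
    rintro ⟨x⟩; exact (Quot.sound (.add_comm x (of 0))).trans (Quot.sound (.zero_add x))
  add_comm := by rintro ⟨x⟩ ⟨y⟩; exact Quot.sound (.add_comm x y)
  nsmul := nsmulRec
  zsmul := zsmulRec
  mul_assoc := by rintro ⟨x⟩ ⟨y⟩ ⟨z⟩; exact Quot.sound (.mul_assoc x y z)
  mul_comm := by rintro ⟨x⟩ ⟨y⟩; exact Quot.sound (.mul_comm x y)
  one_mul := by rintro ⟨x⟩; exact Quot.sound (.one_mul x)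
  mul_one := by
    rintro ⟨x⟩; exact (Quot.sound (.mul_comm x (of 1))).trans (Quot.sound (.one_mul x))
  zero_mul := by rintro ⟨x⟩; exact Quot.sound (.zero_mul x)
  mul_zero := by
    rintro ⟨x⟩; exact (Quot.sound (.mul_comm x (of 0))).trans (Quot.sound (.zero_mul x))
  left_distrib := by rintro ⟨x⟩ ⟨y⟩ ⟨z⟩; exact Quot.sound (.mul_add x y z)
  right_distrib := by
    rintro ⟨x⟩ ⟨y⟩ ⟨z⟩
    refine (Quot.sound (.mul_comm (add x y) z)).trans ((Quot.sound (.mul_add z x y)).trans ?_)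
    exact (Quot.sound (.congr_add_left _ (.mul_comm z x))).trans
      (Quot.sound (.congr_add_right _ (.mul_comm z y)))
  neg_add_cancel := by
    rintro ⟨x⟩
    have h : PoissonExpr.Rel R (of (-1 + 1)) (add (of (-1)) (of (1 : A))) := .of_add (-1) 1
    rw [neg_add_cancel] at h
    change mk R (add (mul (of (-1)) x) x) = mk R (of 0)
    rw [sound (.congr_add_left x (.mul_comm (of (-1)) x)),
      ← sound (.congr_add_right (mul x (of (-1))) (.one_mul x)),
      sound (.congr_add_right (mul x (of (-1))) (.mul_comm (of 1) x)),
      ← sound (.mul_add x (of (-1)) (of 1)), ← sound (.congr_mul_right x h),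
      sound (.mul_comm x (of 0)), sound (.zero_mul x)]

variable (A) in
/-- The structure homomorphism `A → P(A)`. -/
def ofHom : A →+* PoissonEnvelope R A where
  toFun a := mk R (of a)
  map_zero' := rfl
  map_one' := rfl
  map_add' a b := Quot.sound (.of_add a b)
  map_mul' a b := Quot.sound (.of_mul a b)

/-- `P(A)` is an `A`-algebra. -/
instance : Algebra A (PoissonEnvelope R A) := (ofHom R A).toAlgebra

/-- `P(A)` is an `R`-algebra. -/
instance : Algebra R (PoissonEnvelope R A) := ((ofHom R A).comp (algebraMap R A)).toAlgebra

instance : IsScalarTower R A (PoissonEnvelope R A) := .of_algebraMap_eq fun _ => rfl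

variable (A) in
/-- The Poisson bracket of `P(A)`. -/
def poissonBracket : PoissonBracket R (PoissonEnvelope R A) where
  bracket := LinearMap.mk₂ R
    (Quot.map₂ bracket (fun x _ _ h => .congr_bracket_right x h)
      (fun _ _ y h => .congr_bracket_left y h))
    (by rintro ⟨x⟩ ⟨y⟩ ⟨z⟩; exact Quot.sound (.add_bracket x y z))
    (by rintro r ⟨x⟩ ⟨y⟩; exact Quot.sound (.smul_bracket r x y))
    (by rintro ⟨x⟩ ⟨y⟩ ⟨z⟩; exact Quot.sound (.bracket_add x y z))
    (by rintro r ⟨x⟩ ⟨y⟩; exact Quot.sound (.bracket_smul r x y))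
  bracket_self := by rintro ⟨x⟩; exact Quot.sound (.bracket_self x)
  jacobi := by rintro ⟨x⟩ ⟨y⟩ ⟨z⟩; exact Quot.sound (.jacobi x y z)
  leibniz := by rintro ⟨x⟩ ⟨y⟩ ⟨z⟩; exact Quot.sound (.leibniz x y z)

/-- The universal property of the Poisson envelope (it is left adjoint to the functor which forgets
the bracket): a homomorphism of commutative algebras from `A` to a Poisson algebra extends uniquely
to a homomorphism of Poisson algebras from `P(A)`. -/
theorem existsUnique_lift {P : Type*} [CommRing P] [Algebra R P] (b : PoissonBracket R P)
    (f : A →ₐ[R] P) :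
    ∃! g : PoissonEnvelope R A →ₐ[R] P,
      (∀ a, g (algebraMap A (PoissonEnvelope R A) a) = f a) ∧
        ∀ x y, g ((poissonBracket R A).bracket x y) = b.bracket (g x) (g y) := by
  let ev : PoissonExpr A → P := fun x =>
    PoissonExpr.rec (fun a => f a) (fun _ _ u v => u + v) (fun _ _ u v => u * v)
      (fun _ _ u v => b.bracket u v) x
  have ev_of (a) : ev (of a) = f a := rfl
  have ev_add (x y) : ev (add x y) = ev x + ev y := rfl
  have ev_mul (x y) : ev (mul x y) = ev x * ev y := rfl
  have ev_bracket (x y) : ev (bracket x y) = b.bracket (ev x) (ev y) := rfl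
  have ev_rel (x y) (h : PoissonExpr.Rel R x y) : ev x = ev y := by
    induction h with
    | congr_add_left | congr_add_right | congr_mul_left | congr_mul_right | congr_bracket_left
    | congr_bracket_right => simp only [*]
    | bracket_self => simp [ev_of, ev_bracket, b.bracket_self]
    | jacobi => simpa only [ev_add, ev_bracket] using b.jacobi _ _ _
    | leibniz => simpa only [ev_add, ev_mul, ev_bracket] using b.leibniz _ _ _
    | smul_bracket r | bracket_smul r =>
      simp only [ev_mul, ev_of, ev_bracket, AlgHom.commutes, ← Algebra.smul_def, map_smul,
        LinearMap.smul_apply]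
    | _ =>
      simp only [ev_add, ev_mul, ev_of, ev_bracket, map_add, map_mul, map_zero, map_one,
        LinearMap.add_apply]
      try ring
  refine ⟨{ toFun := Quot.lift ev ev_rel
            map_one' := map_one f
            map_mul' := by rintro ⟨x⟩ ⟨y⟩; rfl
            map_zero' := map_zero f
            map_add' := by rintro ⟨x⟩ ⟨y⟩; rfl
            commutes' := f.commutes },
    ⟨fun _ => rfl, by rintro ⟨x⟩ ⟨y⟩; rfl⟩, ?_⟩
  rintro g ⟨hg, hg'⟩
  refine AlgHom.ext ?_
  rintro ⟨x⟩
  change g (mk R x) = ev x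
  induction x with
  | of a => exact hg a
  | add x y hx hy => rw [ev_add, ← hx, ← hy]; exact map_add g (mk R x) (mk R y)
  | mul x y hx hy => rw [ev_mul, ← hx, ← hy]; exact map_mul g (mk R x) (mk R y)
  | bracket x y hx hy => rw [ev_bracket, ← hx, ← hy]; exact hg' (mk R x) (mk R y)

/-- `IsMonomial R d x`: the element `x` of `P(A)` is given by a formal expression, built from
elements of `A` by products and brackets, which contains exactly `d` instances of brackets. -/
inductive IsMonomial : ℕ → PoissonEnvelope R A → Prop
  | of (a : A) : IsMonomial 0 (algebraMap A (PoissonEnvelope R A) a)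
  | mul {m n : ℕ} {x y : PoissonEnvelope R A} :
      IsMonomial m x → IsMonomial n y → IsMonomial (m + n) (x * y)
  | bracket {m n : ℕ} {x y : PoissonEnvelope R A} :
      IsMonomial m x → IsMonomial n y →
        IsMonomial (m + n + 1) ((poissonBracket R A).bracket x y)

variable (A) in
/-- The degree `d` part `P^d(A)` of the Poisson envelope, with its `A`-module structure. -/
def degreePart (d : ℕ) : Submodule A (PoissonEnvelope R A) :=
  Submodule.span A {x | IsMonomial R d x}

end PoissonEnvelope

/-! ### The free Lie algebra of a module and the functors `Q^d` -/

/-- The free Lie `A`-algebra `Lie(M)` of an `A`-module `M`: the quotient of the free Lie algebra on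
the underlying set of `M` by the Lie ideal which makes the generators depend `A`-linearly on the
elements of `M`. -/
abbrev ModuleLie (A M : Type*) [CommRing A] [AddCommGroup M] [Module A M] : Type _ :=
  FreeLieAlgebra A M ⧸ LieSubmodule.lieSpan A (FreeLieAlgebra A M)
    ({z | ∃ x y : M, z = .of A (x + y) - (.of A x + .of A y)} ∪
      {z | ∃ (a : A) (x : M), z = .of A (a • x) - a • .of A x})

namespace ModuleLie

variable (A : Type*) {M : Type*} [CommRing A] [AddCommGroup M] [Module A M]

/-- The canonical `A`-linear map `M → Lie(M)`. -/
def ι : M →ₗ[A] ModuleLie A M where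
  toFun x := LieSubmodule.Quotient.mk (FreeLieAlgebra.of A x)
  map_add' x y := (Submodule.Quotient.eq _).2
    (LieSubmodule.subset_lieSpan (Or.inl ⟨x, y, rfl⟩))
  map_smul' a x := (Submodule.Quotient.eq _).2
    (LieSubmodule.subset_lieSpan (Or.inr ⟨a, x, rfl⟩))

/-- The universal property of `Lie(M)`: a linear map from `M` to a Lie algebra extends uniquely to
a homomorphism of Lie algebras from `Lie(M)`. -/
theorem existsUnique_lift {L : Type*} [LieRing L] [LieAlgebra A L] (f : M →ₗ[A] L) :
    ∃! g : ModuleLie A M →ₗ⁅A⁆ L, ∀ x, g (ι A x) = f x := by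
  let F : FreeLieAlgebra A M →ₗ⁅A⁆ L := FreeLieAlgebra.lift A f
  have hF (x : M) : F (.of A x) = f x := FreeLieAlgebra.lift_of_apply _ x
  have hker : LieSubmodule.lieSpan A (FreeLieAlgebra A M)
      ({z | ∃ x y : M, z = .of A (x + y) - (.of A x + .of A y)} ∪
        {z | ∃ (a : A) (x : M), z = .of A (a • x) - a • .of A x}) ≤ F.ker := by
    rw [LieSubmodule.lieSpan_le]
    rintro z (⟨x, y, rfl⟩ | ⟨a, x, rfl⟩) <;> simp [hF]
  refine ⟨{ Submodule.liftQ _ (F : FreeLieAlgebra A M →ₗ[A] L) (fun z hz => ?_) with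
            map_lie' := ?_ }, fun x => hF x, ?_⟩
  · exact F.mem_ker.1 (hker hz)
  · rintro ⟨x⟩ ⟨y⟩
    exact F.map_lie x y
  · intro g hg
    let π : FreeLieAlgebra A M →ₗ⁅A⁆ ModuleLie A M :=
      { Submodule.mkQ _ with map_lie' := rfl }
    have h : g.comp π = F := FreeLieAlgebra.hom_ext fun x => (hg x).trans (hF x).symm
    refine LieHom.ext ?_
    rintro ⟨x⟩
    exact LieHom.congr_fun h x

/-- `IsMonomial A n z`: the element `z` of `Lie(M)` is an iterated bracket, with any bracketing,
of `n` elements of `M`. -/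
inductive IsMonomial : ℕ → ModuleLie A M → Prop
  | ι (x : M) : IsMonomial 1 (ι A x)
  | lie {m n : ℕ} {x y : ModuleLie A M} :
      IsMonomial m x → IsMonomial n y → IsMonomial (m + n) ⁅x, y⁆

variable (M) in
/-- The degree `n` part `Lie^n(M)` of the free Lie algebra. -/
def degreePart (n : ℕ) : Submodule A (ModuleLie A M) :=
  Submodule.span A {z | IsMonomial A n z}

end ModuleLie

/-- `Lie_{≥ 2}(M)`, the direct sum of the `Lie^n(M)` over `n ≥ 2`; the summand with index `i` is
`Lie^{i + 2}(M)`, and it has degree `i + 1`. -/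
abbrev LiePlus (A M : Type*) [CommRing A] [AddCommGroup M] [Module A M] : Type _ :=
  DirectSum ℕ fun i => ModuleLie.degreePart A M (i + 2)

/-- `Q^d(M)`, the degree `d` part of the symmetric algebra of `Lie_{≥ 2}(M)`: it is spanned by the
products of elements `y j ∈ Lie^{n j + 2}(M)`, which have degree `n j + 1`, with total degree `d`. -/
def QPart (A M : Type*) [CommRing A] [AddCommGroup M] [Module A M] (d : ℕ) :
    Submodule A (SymmetricAlgebra A (LiePlus A M)) :=
  Submodule.span A {z | ∃ (k : ℕ) (n : Fin k → ℕ)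
    (y : ∀ j, ModuleLie.degreePart A M (n j + 2)),
    ∑ j, (n j + 1) = d ∧
      z = ∏ j, SymmetricAlgebra.ι A (LiePlus A M)
        (DirectSum.lof A ℕ (fun i => ModuleLie.degreePart A M (i + 2)) (n j) (y j))}

end

/-! Smoothness is used twice. First, `Ω` is projective, so the presentation of `Ω` by the free
module on the set `A` has a linear section `τ`. The bracket of `P(A)` is not `A`-bilinear, but that
of `A ⊗ P(A)` is. Hence `ω ↦ ∑ τ(ω)_b ⊗ b` extends to a Lie homomorphism `Lie(Ω) → A ⊗ P(A)`
(`lieHom`), and multiplication of scalars gives an `A`-linear map `lieMap : Lie(Ω) → P(A)`. Its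
restriction to `Lie_{≥ 2}(Ω)` extends to an algebra homomorphism `symmetricMap` from the symmetric
algebra to `P(A)`.

Surjectivity in each degree: `lieMap` respects brackets up to terms in which a scalar has been
differentiated, and these are products of two factors of positive degree. So every monomial of
positive degree lies in the image of `lieMap` modulo such products (`mem_of_isMonomial`), and
induction on the degree concludes (`map_symmetricMap`).

Injectivity: let `I` be the augmentation ideal of `Sym(Lie(Ω))` with its Kirillov–Kostant bracket.
The map `a ↦ a + da` is multiplicative modulo `I²`, and formal smoothness lifts it to an algebra
homomorphism modulo any `I^k`. Since `I^k` is a Poisson ideal, this extends to a Poisson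
homomorphism `Φ` from `P(A)` (`exists_ringHom_quotient`). On generators, `Φ ∘ symmetricMap` is the
inclusion of `Lie_{≥ 2}(Ω)` in `Lie(Ω)` up to `I²` (`component_lieMap`). A kernel element therefore
lies in every power of the augmentation ideal, and so vanishes (`injective_of_forall_exists`). -/

namespace SymmetricAlgebra

/-! ### Derivations and biderivations of a symmetric algebra -/

section Derivation

variable {R M : Type*} [CommRing R] [AddCommGroup M] [Module R M]

theorem derivation_ext {D E : Derivation R (SymmetricAlgebra R M) (SymmetricAlgebra R M)}
    (h : ∀ m, D (ι R M m) = E (ι R M m)) : D = E := by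
  ext w
  induction w using SymmetricAlgebra.induction with
  | algebraMap r => simp
  | ι m => exact h m
  | mul a b ha hb => simp [ha, hb]
  | add a b ha hb => simp [ha, hb]

/-- The algebra homomorphism `w ↦ w + ε D w`, where `D` is the derivation which extends `f`. -/
noncomputable def dualLift (f : M →ₗ[R] SymmetricAlgebra R M) :
    SymmetricAlgebra R M →ₐ[R] TrivSqZeroExt (SymmetricAlgebra R M) (SymmetricAlgebra R M) :=
  lift ((TrivSqZeroExt.inlAlgHom R _ _).toLinearMap ∘ₗ ι R M +
    ((TrivSqZeroExt.inrHom (SymmetricAlgebra R M) (SymmetricAlgebra R M)).restrictScalars R) ∘ₗ f)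

theorem fst_dualLift (f : M →ₗ[R] SymmetricAlgebra R M) (w : SymmetricAlgebra R M) :
    (dualLift f w).fst = w := by
  have : (TrivSqZeroExt.fstHom R _ _).comp (dualLift f) = AlgHom.id R _ := by
    ext m; simp [dualLift]
  exact congr($this w)

/-- The derivation of the symmetric algebra which extends a linear map on the generators. -/
noncomputable def derivation (f : M →ₗ[R] SymmetricAlgebra R M) :
    Derivation R (SymmetricAlgebra R M) (SymmetricAlgebra R M) :=
  Derivation.mk' (((TrivSqZeroExt.sndHom (SymmetricAlgebra R M)
    (SymmetricAlgebra R M)).restrictScalars R) ∘ₗ (dualLift f).toLinearMap) fun a b => by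
      simp [fst_dualLift, mul_comm]

@[simp]
theorem derivation_ι (f : M →ₗ[R] SymmetricAlgebra R M) (m : M) :
    derivation f (ι R M m) = f m := by
  simp [derivation, dualLift]

theorem derivation_add (f g : M →ₗ[R] SymmetricAlgebra R M) :
    derivation (f + g) = derivation f + derivation g :=
  derivation_ext fun m => by simp

theorem derivation_smul (r : R) (f : M →ₗ[R] SymmetricAlgebra R M) :
    derivation (r • f) = r • derivation f :=
  derivation_ext fun m => by simp

/-- The biderivation of the symmetric algebra which extends a bilinear map on the generators. -/
noncomputable def biderivation (β : M →ₗ[R] M →ₗ[R] SymmetricAlgebra R M) :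
    SymmetricAlgebra R M →ₗ[R] SymmetricAlgebra R M →ₗ[R] SymmetricAlgebra R M :=
  LinearMap.mk₂ R
    (fun v w => derivation
      { toFun m := derivation (β m) w
        map_add' x y := by simp [derivation_add]
        map_smul' r x := by simp [derivation_smul] } v)
    (fun v v' w => by simp)
    (fun r v w => by simp)
    (fun v w w' => by
      rw [← Derivation.add_apply, ← derivation_add]
      congr 2
      ext m
      simp)
    (fun r v w => by
      rw [← Derivation.smul_apply, ← derivation_smul]
      congr 2
      ext m
      simp)

variable (β : M →ₗ[R] M →ₗ[R] SymmetricAlgebra R M)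

theorem biderivation_mul_left (u v w : SymmetricAlgebra R M) :
    biderivation β (u * v) w = u * biderivation β v w + v * biderivation β u w := by
  simp [biderivation]

theorem biderivation_ι_left (m : M) (w : SymmetricAlgebra R M) :
    biderivation β (ι R M m) w = derivation (β m) w := by
  simp [biderivation]

theorem biderivation_algebraMap_left (r : R) (w : SymmetricAlgebra R M) :
    biderivation β (algebraMap R _ r) w = 0 := by
  simp [biderivation]

theorem biderivation_algebraMap_right (r : R) (w : SymmetricAlgebra R M) :
    biderivation β w (algebraMap R _ r) = 0 := by
  induction w using SymmetricAlgebra.induction with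
  | algebraMap r => simp [biderivation_algebraMap_left]
  | ι m => simp [biderivation_ι_left]
  | mul a b ha hb => simp [biderivation_mul_left, ha, hb]
  | add a b ha hb => simp [ha, hb]

/-- The construction is a derivation in the left argument by design. On the right this is clear only
when the left argument is a generator, and the defect propagates by induction on that argument. -/
theorem biderivation_mul_right (u v w : SymmetricAlgebra R M) :
    biderivation β u (v * w) = biderivation β u v * w + v * biderivation β u w := by
  induction u using SymmetricAlgebra.induction with
  | algebraMap r => simp [biderivation_algebraMap_left]
  | ι m => simp [biderivation_ι_left]; ring
  | mul a b ha hb => simp only [biderivation_mul_left, ha, hb]; ring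
  | add a b ha hb => simp only [map_add, LinearMap.add_apply, ha, hb]; ring

end Derivation

/-! ### The Kirillov–Kostant bracket -/

section Poisson

variable {R L : Type*} [CommRing R] [LieRing L] [LieAlgebra R L]

variable (R L) in
/-- The Kirillov–Kostant bracket on the symmetric algebra of a Lie algebra. -/
noncomputable def lieBracket :
    SymmetricAlgebra R L →ₗ[R] SymmetricAlgebra R L →ₗ[R] SymmetricAlgebra R L :=
  biderivation ((LieModule.toEnd R L L : L →ₗ[R] Module.End R L).compr₂ (ι R L))

@[simp]
theorem lieBracket_ι (x y : L) : lieBracket R L (ι R L x) (ι R L y) = ι R L ⁅x, y⁆ := by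
  simp [lieBracket, biderivation_ι_left]

theorem lieBracket_mul_left (u v w : SymmetricAlgebra R L) :
    lieBracket R L (u * v) w = u * lieBracket R L v w + v * lieBracket R L u w :=
  biderivation_mul_left _ u v w

theorem lieBracket_mul_right (u v w : SymmetricAlgebra R L) :
    lieBracket R L u (v * w) = lieBracket R L u v * w + v * lieBracket R L u w :=
  biderivation_mul_right _ u v w

@[simp]
theorem lieBracket_algebraMap_left (r : R) (w : SymmetricAlgebra R L) :
    lieBracket R L (algebraMap R _ r) w = 0 :=
  biderivation_algebraMap_left _ r w

@[simp]
theorem lieBracket_algebraMap_right (r : R) (w : SymmetricAlgebra R L) :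
    lieBracket R L w (algebraMap R _ r) = 0 :=
  biderivation_algebraMap_right _ r w

theorem lieBracket_skew (u v : SymmetricAlgebra R L) :
    lieBracket R L u v = - lieBracket R L v u := by
  induction u using SymmetricAlgebra.induction with
  | algebraMap r => simp
  | ι x =>
    induction v using SymmetricAlgebra.induction with
    | algebraMap r => simp
    | ι y => simp [← map_neg]
    | mul a b ha hb => rw [lieBracket_mul_left, lieBracket_mul_right, ha, hb]; ring
    | add a b ha hb => rw [map_add, ha, hb, map_add, LinearMap.add_apply]; ring
  | mul a b ha hb => rw [lieBracket_mul_left, lieBracket_mul_right, ha, hb]; ring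
  | add a b ha hb => rw [map_add, map_add, LinearMap.add_apply, ha, hb]; ring

/-- Skew-symmetry alone does not suffice, since 2 need not be invertible. -/
theorem lieBracket_self (u : SymmetricAlgebra R L) : lieBracket R L u u = 0 := by
  induction u using SymmetricAlgebra.induction with
  | algebraMap r => simp
  | ι x => simp
  | mul a b ha hb =>
    rw [lieBracket_mul_left, lieBracket_mul_right, lieBracket_mul_right, ha, hb,
      lieBracket_skew a b]
    ring
  | add a b ha hb => simp [ha, hb, lieBracket_skew a b]

/-- The defect of the identity is a derivation in each argument, so it is enough to check
generators, where it is the Jacobi identity of `L`. -/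
theorem lieBracket_jacobi (u v w : SymmetricAlgebra R L) :
    lieBracket R L u (lieBracket R L v w) =
      lieBracket R L (lieBracket R L u v) w + lieBracket R L v (lieBracket R L u w) := by
  induction u using SymmetricAlgebra.induction with
  | algebraMap r => simp
  | ι x =>
    induction v using SymmetricAlgebra.induction with
    | algebraMap r => simp
    | ι y =>
      induction w using SymmetricAlgebra.induction with
      | algebraMap r => simp
      | ι z => simp
      | mul a b ha hb =>
        simp only [lieBracket_mul_right, map_add, ha, hb]
        ring
      | add a b ha hb => simp only [map_add, ha, hb]; ring
    | mul a b ha hb =>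
      simp only [lieBracket_mul_left, lieBracket_mul_right, map_add, LinearMap.add_apply, ha, hb]
      ring
    | add a b ha hb => simp only [map_add, LinearMap.add_apply, ha, hb]; ring
  | mul a b ha hb =>
    simp only [lieBracket_mul_left, lieBracket_mul_right, map_add, LinearMap.add_apply, ha, hb]
    rw [lieBracket_skew v a, lieBracket_skew v b]
    ring
  | add a b ha hb => simp only [map_add, LinearMap.add_apply, ha, hb]; ring

end Poisson

/-! ### Powers of the augmentation ideal -/

section Augmentation

variable (R M : Type*) [CommRing R] [AddCommGroup M] [Module R M]

/-- The augmentation ideal of the symmetric algebra, generated by the module. -/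
noncomputable def augIdeal : Ideal (SymmetricAlgebra R M) := Ideal.span (Set.range (ι R M))

variable {R M}

theorem ι_mem_augIdeal (m : M) : ι R M m ∈ augIdeal R M := Ideal.subset_span ⟨m, rfl⟩

theorem map_augIdeal_pow_le {B : Type*} [CommRing B] [Algebra R B]
    (f : SymmetricAlgebra R M →ₐ[R] B) (N : Ideal B) (h : ∀ m, f (ι R M m) ∈ N) {j : ℕ}
    {q : SymmetricAlgebra R M} (hq : q ∈ augIdeal R M ^ j) : f q ∈ N ^ j := by
  have h1 : (augIdeal R M).map f ≤ N := by
    rw [Ideal.map_le_iff_le_comap, augIdeal, Ideal.span_le]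
    rintro _ ⟨m, rfl⟩
    exact h m
  exact (Ideal.pow_right_mono h1 j) (by rw [← Ideal.map_pow]; exact Ideal.mem_map_of_mem f hq)

/-- The augmentation ideal of a symmetric algebra is separated. -/
theorem eq_zero_of_forall_mem_augIdeal_pow {q : SymmetricAlgebra R M}
    (h : ∀ j, q ∈ augIdeal R M ^ j) : q = 0 := by
  -- Scaling the generators by a variable `X` records the grading: the `(n + 1)`-st power of the
  -- ideal goes to multiples of `X ^ (n + 1)`, which have no coefficient in degree `n`, while `X =
  -- 1` gives back the element.
  let f : SymmetricAlgebra R M →ₐ[R] Polynomial (SymmetricAlgebra R M) :=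
    lift (LinearMap.mulLeft R Polynomial.X ∘ₗ
      (Polynomial.CAlgHom (R := R) (A := SymmetricAlgebra R M)).toLinearMap ∘ₗ ι R M)
  have hf (m : M) : f (ι R M m) = Polynomial.X * Polynomial.C (ι R M m) := by simp [f]
  have hid : ((Polynomial.aeval (1 : SymmetricAlgebra R M)).restrictScalars R).comp f =
      AlgHom.id R _ := by
    ext m
    simp [hf]
  have h0 : f q = 0 := by
    ext n
    have hq := map_augIdeal_pow_le f (Ideal.span {Polynomial.X})
      (fun m => by rw [hf, Ideal.mem_span_singleton]; exact dvd_mul_right _ _) (h (n + 1))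
    rw [Ideal.span_singleton_pow, Ideal.mem_span_singleton, Polynomial.X_pow_dvd_iff] at hq
    simpa using hq n (Nat.lt_succ_self n)
  have := congr($hid q)
  simpa [h0] using this.symm

/-- Two ring homomorphisms which agree to first order on the symmetric algebra agree to
order `j + 1` on the `j`-th power of the augmentation ideal. -/
theorem sub_mem_pow_of_mem_augIdeal_pow {B : Type*} [CommRing B]
    (f g : SymmetricAlgebra R M →+* B) (N : Ideal B)
    (h0 : ∀ r : R, f (algebraMap R _ r) - g (algebraMap R _ r) ∈ N)
    (h1 : ∀ m, f (ι R M m) - g (ι R M m) ∈ N ^ 2) (hg : ∀ m, g (ι R M m) ∈ N) {j : ℕ}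
    {q : SymmetricAlgebra R M} (hq : q ∈ augIdeal R M ^ j) :
    f q - g q ∈ N ^ (j + 1) ∧ g q ∈ N ^ j := by
  have hall (q : SymmetricAlgebra R M) : f q - g q ∈ N := by
    induction q using SymmetricAlgebra.induction with
    | algebraMap r => exact h0 r
    | ι m => exact Ideal.pow_le_self two_ne_zero (h1 m)
    | mul a b ha hb =>
      have : f (a * b) - g (a * b) = f a * (f b - g b) + g b * (f a - g a) := by
        rw [map_mul, map_mul]; ring
      rw [this]
      exact N.add_mem (N.mul_mem_left _ hb) (N.mul_mem_left _ ha)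
    | add a b ha hb =>
      have : f (a + b) - g (a + b) = (f a - g a) + (f b - g b) := by
        rw [map_add, map_add]; ring
      rw [this]
      exact N.add_mem ha hb
  have hI (q) (hq : q ∈ augIdeal R M) : f q - g q ∈ N ^ 2 ∧ g q ∈ N := by
    induction hq using Submodule.span_induction with
    | mem x hx => obtain ⟨m, rfl⟩ := hx; exact ⟨h1 m, hg m⟩
    | zero => simp
    | add x y _ _ hx hy =>
      have : f (x + y) - g (x + y) = (f x - g x) + (f y - g y) := by
        rw [map_add, map_add]; ring
      rw [this, map_add]
      exact ⟨add_mem hx.1 hy.1, add_mem hx.2 hy.2⟩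
    | smul a x _ hx =>
      have : f (a • x) - g (a • x) = f a * (f x - g x) + (f a - g a) * g x := by
        rw [smul_eq_mul, map_mul, map_mul]; ring
      rw [this, smul_eq_mul, map_mul, sq]
      exact ⟨add_mem (Ideal.mul_mem_left _ _ (sq N ▸ hx.1)) (Ideal.mul_mem_mul (hall a) hx.2),
        Ideal.mul_mem_left _ _ hx.2⟩
  induction j generalizing q with
  | zero => simpa using hall q
  | succ j ih =>
    rw [pow_succ] at hq
    induction hq using Submodule.mul_induction_on' with
    | mem_mul_mem x hx y hy =>
      obtain ⟨hx1, hx2⟩ := ih hx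
      obtain ⟨hy1, hy2⟩ := hI y hy
      -- The two terms have orders `(j + 1) + 1` and `j + 2`; the second is why agreement modulo `N
      -- ^ 2` is required on generators.
      have : f (x * y) - g (x * y) = (f x - g x) * f y + g x * (f y - g y) := by
        rw [map_mul, map_mul]; ring
      have hfy : f y ∈ N := by
        have := N.add_mem (Ideal.pow_le_self two_ne_zero hy1) hy2
        simpa using this
      rw [this, map_mul]
      refine ⟨add_mem ?_ ?_, ?_⟩
      · rw [pow_succ N (j + 1)]; exact Ideal.mul_mem_mul hx1 hfy
      · rw [add_assoc, pow_add]; exact Ideal.mul_mem_mul hx2 hy1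
      · rw [pow_succ]; exact Ideal.mul_mem_mul hx2 hy2
    | add x hx y hy hx' hy' =>
      have : f (x + y) - g (x + y) = (f x - g x) + (f y - g y) := by
        rw [map_add, map_add]; ring
      rw [this, map_add]
      exact ⟨add_mem hx'.1 hy'.1, add_mem hx'.2 hy'.2⟩

end Augmentation

end SymmetricAlgebra

/-! ### Quotients of Poisson algebras -/

/-- The Poisson bracket on the quotient of a Poisson algebra by a Poisson ideal. -/
noncomputable def PoissonBracket.quotient {R P : Type*} [CommRing R] [CommRing P] [Algebra R P]
    (b : PoissonBracket R P) (I : Ideal P) (hl : ∀ x, ∀ y ∈ I, b.bracket y x ∈ I)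
    (hr : ∀ x, ∀ y ∈ I, b.bracket x y ∈ I) : PoissonBracket R (P ⧸ I) :=
  have h (x y : P) : Ideal.Quotient.mk I (b.bracket (Quotient.out (Ideal.Quotient.mk I x))
      (Quotient.out (Ideal.Quotient.mk I y))) = Ideal.Quotient.mk I (b.bracket x y) := by
    set x' := Quotient.out (Ideal.Quotient.mk I x) with hx'
    set y' := Quotient.out (Ideal.Quotient.mk I y) with hy'
    have hx : x' - x ∈ I := Ideal.Quotient.eq.1 (Quotient.out_eq _)
    have hy : y' - y ∈ I := Ideal.Quotient.eq.1 (Quotient.out_eq _)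
    rw [Ideal.Quotient.eq]
    have : b.bracket x' y' - b.bracket x y = b.bracket (x' - x) y' + b.bracket x (y' - y) := by
      simp
    rw [this]
    exact I.add_mem (hl _ _ hx) (hr _ _ hy)
  have hs (r : R) (x : P) : Ideal.Quotient.mk I (r • x) = r • Ideal.Quotient.mk I x := rfl
  { bracket := LinearMap.mk₂ R
      (fun x y => Ideal.Quotient.mk I (b.bracket (Quotient.out x) (Quotient.out y)))
      (fun x y z => by
        obtain ⟨x, rfl⟩ := Ideal.Quotient.mk_surjective x
        obtain ⟨y, rfl⟩ := Ideal.Quotient.mk_surjective y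
        obtain ⟨z, rfl⟩ := Ideal.Quotient.mk_surjective z
        rw [← map_add, h, h, h]
        simp)
      (fun r x y => by
        obtain ⟨x, rfl⟩ := Ideal.Quotient.mk_surjective x
        obtain ⟨y, rfl⟩ := Ideal.Quotient.mk_surjective y
        rw [← hs, h, h, map_smul, LinearMap.smul_apply, hs])
      (fun x y z => by
        obtain ⟨x, rfl⟩ := Ideal.Quotient.mk_surjective x
        obtain ⟨y, rfl⟩ := Ideal.Quotient.mk_surjective y
        obtain ⟨z, rfl⟩ := Ideal.Quotient.mk_surjective z
        rw [← map_add, h, h, h]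
        simp)
      (fun r x y => by
        obtain ⟨x, rfl⟩ := Ideal.Quotient.mk_surjective x
        obtain ⟨y, rfl⟩ := Ideal.Quotient.mk_surjective y
        rw [← hs, h, h, map_smul, hs])
    bracket_self x := by
      obtain ⟨x, rfl⟩ := Ideal.Quotient.mk_surjective x
      rw [LinearMap.mk₂_apply, h, b.bracket_self, map_zero]
    jacobi x y z := by
      obtain ⟨x, rfl⟩ := Ideal.Quotient.mk_surjective x
      obtain ⟨y, rfl⟩ := Ideal.Quotient.mk_surjective y
      obtain ⟨z, rfl⟩ := Ideal.Quotient.mk_surjective z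
      simp only [LinearMap.mk₂_apply, h]
      rw [b.jacobi, map_add]
    leibniz x y z := by
      obtain ⟨x, rfl⟩ := Ideal.Quotient.mk_surjective x
      obtain ⟨y, rfl⟩ := Ideal.Quotient.mk_surjective y
      obtain ⟨z, rfl⟩ := Ideal.Quotient.mk_surjective z
      rw [← map_mul]
      simp only [LinearMap.mk₂_apply, h]
      rw [b.leibniz, map_add, map_mul, map_mul] }

theorem PoissonBracket.quotient_mk {R P : Type*} [CommRing R] [CommRing P] [Algebra R P]
    (b : PoissonBracket R P) (I : Ideal P) (hl : ∀ x, ∀ y ∈ I, b.bracket y x ∈ I)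
    (hr : ∀ x, ∀ y ∈ I, b.bracket x y ∈ I) (x y : P) :
    (b.quotient I hl hr).bracket (Ideal.Quotient.mk I x) (Ideal.Quotient.mk I y) =
      Ideal.Quotient.mk I (b.bracket x y) := by
  have hx : Quotient.out (Ideal.Quotient.mk I x) - x ∈ I := Ideal.Quotient.eq.1 (Quotient.out_eq _)
  have hy : Quotient.out (Ideal.Quotient.mk I y) - y ∈ I := Ideal.Quotient.eq.1 (Quotient.out_eq _)
  refine Ideal.Quotient.eq.2 ?_
  have := I.add_mem (hl (Quotient.out (Ideal.Quotient.mk I y)) _ hx) (hr x _ hy)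
  simpa using this

namespace SymmetricAlgebra

/-! ### First-order expansion in a symmetric algebra -/

section LinearPart

variable {R M : Type*} [CommRing R] [AddCommGroup M] [Module R M]

/-- The component in `M` of an element of the symmetric algebra of `M`. -/
noncomputable def linearPart : SymmetricAlgebra R M →ₗ[R] M :=
  letI : Module Rᵐᵒᵖ M := Module.compHom _ ((RingHom.id R).fromOpposite mul_comm)
  haveI : IsCentralScalar R M := ⟨fun _ _ => rfl⟩
  TrivSqZeroExt.sndHom R M ∘ₗ (lift (TrivSqZeroExt.inrHom R M)).toLinearMap

@[simp]
theorem linearPart_ι (m : M) : linearPart (ι R M m) = m := by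
  simp [linearPart]

@[simp]
theorem linearPart_algebraMap (r : R) : linearPart (algebraMap R (SymmetricAlgebra R M) r) = 0 := by
  let _ : Module Rᵐᵒᵖ M := Module.compHom _ ((RingHom.id R).fromOpposite mul_comm)
  have : IsCentralScalar R M := ⟨fun _ _ => rfl⟩
  simp [linearPart, TrivSqZeroExt.algebraMap_eq_inl]

theorem linearPart_mul (u v : SymmetricAlgebra R M) :
    linearPart (u * v) = algebraMapInv u • linearPart v + algebraMapInv v • linearPart u := by
  let _ : Module Rᵐᵒᵖ M := Module.compHom _ ((RingHom.id R).fromOpposite mul_comm)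
  have : IsCentralScalar R M := ⟨fun _ _ => rfl⟩
  have h : (TrivSqZeroExt.fstHom R R M).comp (lift (TrivSqZeroExt.inrHom R M)) =
      algebraMapInv := by
    ext m
    simp [algebraMapInv]
  have h' (w) : (lift (TrivSqZeroExt.inrHom R M) w).fst = algebraMapInv w := congr($h w)
  simp [linearPart, h']

theorem algebraMapInv_eq_zero {u : SymmetricAlgebra R M} (hu : u ∈ augIdeal R M) :
    algebraMapInv u = 0 := by
  have := map_augIdeal_pow_le (algebraMapInv : SymmetricAlgebra R M →ₐ[R] R) ⊥
    (fun m => by simp [algebraMapInv_ι]) (j := 1) (by simpa using hu)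
  simpa using this

theorem linearPart_eq_zero {u : SymmetricAlgebra R M} (hu : u ∈ augIdeal R M ^ 2) :
    linearPart u = 0 := by
  rw [sq] at hu
  induction hu using Submodule.mul_induction_on' with
  | mem_mul_mem x hx y hy =>
    simp [linearPart_mul, algebraMapInv_eq_zero hx, algebraMapInv_eq_zero hy]
  | add x _ y _ hx hy => rw [map_add, hx, hy, add_zero]

/-- This is the first-order Taylor expansion; for a product, the only new term is the product of the
two linear parts, which has order two. -/
theorem sub_sub_mem_augIdeal_sq (u : SymmetricAlgebra R M) :
    u - algebraMap R _ (algebraMapInv u) - ι R M (linearPart u) ∈ augIdeal R M ^ 2 := by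
  induction u using SymmetricAlgebra.induction with
  | algebraMap r => simp [algebraMap_leftInverse M r]
  | ι m => simp [algebraMapInv_ι]
  | mul a b ha hb =>
    set p := a - algebraMap R _ (algebraMapInv a) - ι R M (linearPart a) with hp
    set q := b - algebraMap R _ (algebraMapInv b) - ι R M (linearPart b) with hq
    have key : a * b - algebraMap R _ (algebraMapInv (a * b)) - ι R M (linearPart (a * b)) =
        p * b + (a - p) * q + ι R M (linearPart a) * ι R M (linearPart b) := by
      rw [hp, hq, linearPart_mul, map_mul, map_mul, map_add, map_smul, map_smul, Algebra.smul_def,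
        Algebra.smul_def]
      ring
    rw [key]
    refine add_mem (add_mem (Ideal.mul_mem_right _ _ ha) (Ideal.mul_mem_left _ _ hb)) ?_
    rw [sq]
    exact Ideal.mul_mem_mul (ι_mem_augIdeal _) (ι_mem_augIdeal _)
  | add a b ha hb =>
    have := add_mem ha hb
    rw [map_add, map_add, map_add, map_add]
    convert this using 1
    ring

end LinearPart

/-! ### Nilpotent Poisson quotients and lifting of derivations -/

section Poisson

variable {R A L : Type*} [CommRing A] [LieRing L] [LieAlgebra A L]

theorem lieBracket_mem_augIdeal (u v : SymmetricAlgebra A L) :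
    lieBracket A L u v ∈ augIdeal A L := by
  induction u using SymmetricAlgebra.induction with
  | algebraMap r => simp
  | ι x =>
    induction v using SymmetricAlgebra.induction with
    | algebraMap r => simp
    | ι y => simp [ι_mem_augIdeal]
    | mul a b ha hb =>
      rw [lieBracket_mul_right]
      exact add_mem (Ideal.mul_mem_right _ _ ha) (Ideal.mul_mem_left _ _ hb)
    | add a b ha hb => rw [map_add]; exact add_mem ha hb
  | mul a b ha hb =>
    rw [lieBracket_mul_left]
    exact add_mem (Ideal.mul_mem_left _ _ hb) (Ideal.mul_mem_left _ _ ha)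
  | add a b ha hb => rw [map_add]; exact add_mem ha hb

/-- Scalars are central, so every bracket already lies in the augmentation ideal; by the Leibniz
rule, bracketing a product of `k` factors keeps `k` factors in the ideal. Hence the powers are
Poisson ideals. -/
theorem lieBracket_mem_augIdeal_pow (k : ℕ) (u : SymmetricAlgebra A L) :
    ∀ v ∈ augIdeal A L ^ k, lieBracket A L u v ∈ augIdeal A L ^ k := by
  induction k with
  | zero => simp
  | succ k ih =>
    intro v hv
    rw [pow_succ] at hv ⊢
    induction hv using Submodule.mul_induction_on' with
    | mem_mul_mem x hx y hy =>
      rw [lieBracket_mul_right]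
      exact add_mem (Ideal.mul_mem_mul (ih x hx) hy)
        (Ideal.mul_mem_mul hx (lieBracket_mem_augIdeal _ _))
    | add x _ y _ hx hy => rw [map_add]; exact add_mem hx hy

/-- Brackets have no constant term, so in the Leibniz expansions the linear part only sees constant
times linear terms. -/
theorem linearPart_lieBracket (u v : SymmetricAlgebra A L) :
    linearPart (lieBracket A L u v) = ⁅linearPart u, linearPart v⁆ := by
  have h0 (u v : SymmetricAlgebra A L) : algebraMapInv (lieBracket A L u v) = 0 :=
    algebraMapInv_eq_zero (lieBracket_mem_augIdeal u v)
  induction u using SymmetricAlgebra.induction with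
  | algebraMap r => simp
  | ι x =>
    induction v using SymmetricAlgebra.induction with
    | algebraMap r => simp
    | ι y => simp
    | mul a b ha hb => simp [lieBracket_mul_right, linearPart_mul, h0, ha, hb, add_comm]
    | add a b ha hb => simp [ha, hb]
  | mul a b ha hb => simp [lieBracket_mul_left, linearPart_mul, h0, ha, hb]
  | add a b ha hb => simp [ha, hb]

variable (R A L) [CommRing R] [Algebra R A] [Module R L] [IsScalarTower R A L]

/-- The symmetric algebra of a Lie algebra, as a Poisson algebra. -/
noncomputable def poissonBracket : PoissonBracket R (SymmetricAlgebra A L) where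
  bracket := (lieBracket A L).restrictScalars₁₂ R R
  bracket_self := lieBracket_self
  jacobi := lieBracket_jacobi
  leibniz := lieBracket_mul_right

/-- The quotient of the Poisson algebra `Sym(L)` by a power of the augmentation ideal. -/
noncomputable def quotientPoissonBracket (k : ℕ) :
    PoissonBracket R (SymmetricAlgebra A L ⧸ augIdeal A L ^ k) :=
  (poissonBracket R A L).quotient _
    (fun u v hv => by
      change lieBracket A L v u ∈ _
      rw [lieBracket_skew]
      exact neg_mem (lieBracket_mem_augIdeal_pow k u v hv))
    (fun u v hv => lieBracket_mem_augIdeal_pow k u v hv)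

theorem quotientPoissonBracket_mk (k : ℕ) (u v : SymmetricAlgebra A L) :
    (quotientPoissonBracket R A L k).bracket (Ideal.Quotient.mk _ u) (Ideal.Quotient.mk _ v) =
      Ideal.Quotient.mk _ (lieBracket A L u v) :=
  PoissonBracket.quotient_mk ..

variable {R A L}

/-- A derivation `D` from a formally smooth algebra `A` to a Lie `A`-algebra `L` lifts to
homomorphisms from `A` to the nilpotent thickenings of `A` in the spectrum of `Sym(L)`. -/
theorem exists_algHom_quotient [Algebra.FormallySmooth R A] (D : Derivation R A L) {k : ℕ}
    (hk : 2 ≤ k) : ∃ s : A →ₐ[R] SymmetricAlgebra A L ⧸ augIdeal A L ^ k,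
      ∀ a w, s a = Ideal.Quotient.mk _ w → algebraMapInv w = a ∧ linearPart w = D a := by
  have h2 : augIdeal A L ^ k ≤ augIdeal A L ^ 2 := Ideal.pow_le_pow_right hk
  -- The map `a ↦ a + D a`; its failure to be multiplicative is `-D a * D b`, of order two.
  let f : A →ₐ[R] SymmetricAlgebra A L ⧸ augIdeal A L ^ 2 :=
    AlgHom.ofLinearMap ((Ideal.Quotient.mkₐ R (augIdeal A L ^ 2)).toLinearMap ∘ₗ
      ((Algebra.linearMap A (SymmetricAlgebra A L)).restrictScalars R +
        (ι A L).restrictScalars R ∘ₗ (D : A →ₗ[R] L)))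
      (by simp)
      (fun a b => by
        simp only [LinearMap.comp_apply, AlgHom.toLinearMap_apply, ← map_mul]
        refine Ideal.Quotient.eq.2 ?_
        simp only [LinearMap.add_apply, LinearMap.comp_apply, LinearMap.restrictScalars_apply,
          Algebra.linearMap_apply, Derivation.coeFn_coe, Derivation.leibniz, map_add, map_smul,
          map_mul, Algebra.smul_def]
        have : ι A L (D a) * ι A L (D b) ∈ augIdeal A L ^ 2 := by
          rw [sq]; exact Ideal.mul_mem_mul (ι_mem_augIdeal _) (ι_mem_augIdeal _)
        convert neg_mem this using 1
        ring)
  have hf (a : A) : f a = Ideal.Quotient.mk _ (algebraMap A _ a + ι A L (D a)) := rfl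
  let g : (SymmetricAlgebra A L ⧸ augIdeal A L ^ k) →ₐ[R] SymmetricAlgebra A L ⧸ augIdeal A L ^ 2 :=
    Ideal.Quotient.factorₐ R h2
  have hg (w) : g (Ideal.Quotient.mk _ w) = Ideal.Quotient.mk _ w := rfl
  have hgs : Function.Surjective g := Ideal.Quotient.factor_surjective h2
  have hker : IsNilpotent (RingHom.ker g.toRingHom) := by
    refine ⟨k, ?_⟩
    have : RingHom.ker g.toRingHom ≤
        (augIdeal A L).map (Ideal.Quotient.mk (augIdeal A L ^ k)) := by
      intro x hx
      obtain ⟨x, rfl⟩ := Ideal.Quotient.mk_surjective x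
      have hx' : x ∈ augIdeal A L ^ 2 := Ideal.Quotient.eq_zero_iff_mem.1 hx
      exact Ideal.mem_map_of_mem _ (Ideal.pow_le_self two_ne_zero hx')
    refine le_bot_iff.1 ((Ideal.pow_right_mono this k).trans ?_)
    rw [← Ideal.map_pow, Ideal.map_quotient_self]
  refine ⟨Algebra.FormallySmooth.liftOfSurjective f g hgs hker, fun a w hw => ?_⟩
  have := Algebra.FormallySmooth.liftOfSurjective_apply f g hgs hker a
  rw [hw, hg, hf, Ideal.Quotient.eq] at this
  have h1 := algebraMapInv_eq_zero (Ideal.pow_le_self two_ne_zero this)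
  have h3 := linearPart_eq_zero this
  rw [map_sub, map_add, algebraMapInv_ι, algebraMap_leftInverse L a, add_zero, sub_eq_zero] at h1
  rw [map_sub, map_add, linearPart_ι, linearPart_algebraMap, zero_add, sub_eq_zero] at h3
  exact ⟨h1, h3⟩

end Poisson

end SymmetricAlgebra

/-! ### Poisson homomorphisms from `P(A)` to nilpotent quotients -/

namespace PoissonEnvelope

open SymmetricAlgebra

variable {R A L : Type*} [CommRing R] [CommRing A] [Algebra R A] [LieRing L] [LieAlgebra A L]
  [Module R L] [IsScalarTower R A L]

/-- The Poisson homomorphism from `P(A)` to a truncation of the Poisson algebra `Sym(L)` which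
is determined by a derivation from a formally smooth algebra `A` to `L`, with its components `ε`
and `δ` of degree zero and one. -/
theorem exists_ringHom_quotient [Algebra.FormallySmooth R A] (D : Derivation R A L) {k : ℕ}
    (hk : 2 ≤ k) :
    ∃ (Φ : PoissonEnvelope R A →+* SymmetricAlgebra A L ⧸ augIdeal A L ^ k)
      (ε : PoissonEnvelope R A →ₐ[R] A) (δ : PoissonEnvelope R A →ₗ[R] L),
      (∀ x, ∃ w, Φ x = Ideal.Quotient.mk _ w ∧
        w - algebraMap A _ (ε x) - ι A L (δ x) ∈ augIdeal A L ^ 2) ∧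
      (∀ a, ε (algebraMap A _ a) = a ∧ δ (algebraMap A _ a) = D a) ∧
      (∀ x y, ε ((poissonBracket R A).bracket x y) = 0 ∧
        δ ((poissonBracket R A).bracket x y) = ⁅δ x, δ y⁆) ∧
      ∀ x y, δ (x * y) = ε x • δ y + ε y • δ x := by
  obtain ⟨s, hs⟩ := exists_algHom_quotient D hk
  obtain ⟨Φ, ⟨hΦ, hb⟩, -⟩ := existsUnique_lift R (quotientPoissonBracket R A L k) s
  have hk1 : augIdeal A L ^ k ≤ augIdeal A L := Ideal.pow_le_self (by omega)
  have hk2 : augIdeal A L ^ k ≤ augIdeal A L ^ 2 := Ideal.pow_le_pow_right hk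
  choose w hw using fun x => Ideal.Quotient.mk_surjective (Φ x)
  -- As `k ≥ 2`, the constant and linear parts do not depend on the chosen representative.
  have key (x) (v) (hv : Φ x = Ideal.Quotient.mk _ v) :
      algebraMapInv (w x) = algebraMapInv v ∧ linearPart (w x) = linearPart v := by
    have h := Ideal.Quotient.eq.1 ((hw x).trans hv)
    refine ⟨sub_eq_zero.1 ?_, sub_eq_zero.1 ?_⟩
    · rw [← map_sub]; exact algebraMapInv_eq_zero (hk1 h)
    · rw [← map_sub]; exact linearPart_eq_zero (hk2 h)
  have hadd (x y) := key (x + y) (w x + w y) (by rw [map_add, map_add, hw, hw])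
  have hmul (x y) := key (x * y) (w x * w y) (by rw [map_mul, map_mul, hw, hw])
  have hsmul (r : R) (x) := key (r • x) (r • w x)
    (by rw [map_smul, ← Ideal.Quotient.mkₐ_eq_mk R, map_smul, Ideal.Quotient.mkₐ_eq_mk, hw])
  have hlie (x y) := key ((PoissonEnvelope.poissonBracket R A).bracket x y)
    (lieBracket A L (w x) (w y)) (by
      rw [hb, ← SymmetricAlgebra.quotientPoissonBracket_mk R A L, hw, hw])
  have hof (a) : algebraMapInv (w (algebraMap A _ a)) = a ∧
      linearPart (w (algebraMap A _ a)) = D a := hs a _ (by rw [hw, hΦ])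
  let e : PoissonEnvelope R A →ₗ[R] A :=
    { toFun x := algebraMapInv (w x)
      map_add' x y := by rw [(hadd x y).1, map_add]
      map_smul' r x := by
        rw [(hsmul r x).1, RingHom.id_apply, algebra_compatible_smul A r, map_smul,
          ← algebra_compatible_smul] }
  refine ⟨(Φ : _ →+* _), AlgHom.ofLinearMap e ?_ ?_,
    { toFun x := linearPart (w x)
      map_add' x y := by rw [(hadd x y).2, map_add]
      map_smul' r x := by
        rw [(hsmul r x).2, RingHom.id_apply, algebra_compatible_smul A r, map_smul,
          ← algebra_compatible_smul] }, ?_, hof, ?_, ?_⟩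
  · exact (congrArg (fun x => algebraMapInv (w x)) (map_one (algebraMap A _))).symm.trans (hof 1).1
  · intro x y
    exact (hmul x y).1.trans (map_mul _ _ _)
  · exact fun x => ⟨w x, (hw x).symm, sub_sub_mem_augIdeal_sq (w x)⟩
  · intro x y
    refine ⟨(hlie x y).1.trans (algebraMapInv_eq_zero (lieBracket_mem_augIdeal _ _)), ?_⟩
    exact (hlie x y).2.trans (linearPart_lieBracket _ _)
  · intro x y
    exact (hmul x y).2.trans (linearPart_mul _ _)

end PoissonEnvelope

/-! ### The grading of the free Lie algebra -/

namespace ModuleLie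

variable {A M : Type*} [CommRing A] [AddCommGroup M] [Module A M]

theorem hom_ext {L : Type*} [LieRing L] [LieAlgebra A L] {f g : ModuleLie A M →ₗ⁅A⁆ L}
    (h : ∀ x, f (ι A x) = g (ι A x)) : f = g :=
  (existsUnique_lift A ((g : ModuleLie A M →ₗ[A] L) ∘ₗ ι A)).unique h fun _ => rfl

variable (A) in
/-- The homomorphism of Lie algebras from `Lie(M)` which extends a linear map. -/
noncomputable def lift {L : Type*} [LieRing L] [LieAlgebra A L] (f : M →ₗ[A] L) :
    ModuleLie A M →ₗ⁅A⁆ L :=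
  (existsUnique_lift A f).choose

@[simp]
theorem lift_ι {L : Type*} [LieRing L] [LieAlgebra A L] (f : M →ₗ[A] L) (x : M) :
    lift A f (ι A x) = f x :=
  (existsUnique_lift A f).choose_spec.1 x

theorem lie_mem_degreePart {m n : ℕ} {u v : ModuleLie A M} (hu : u ∈ degreePart A M m)
    (hv : v ∈ degreePart A M n) : ⁅u, v⁆ ∈ degreePart A M (m + n) := by
  refine Submodule.span_induction₂ (p := fun x y _ _ => ⁅x, y⁆ ∈ degreePart A M (m + n))
    ?_ ?_ ?_ ?_ ?_ ?_ ?_ hu hv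
  · intro x y hx hy
    exact Submodule.subset_span (hx.lie hy)
  · intro x _
    simp
  · intro x _
    rw [show ⁅x, (0 : ModuleLie A M)⁆ = 0 from lie_zero x]
    exact zero_mem _
  · intro x y z _ _ _ h1 h2
    rw [add_lie]
    exact add_mem h1 h2
  · intro x y z _ _ _ h1 h2
    rw [show ⁅x, y + z⁆ = ⁅x, y⁆ + ⁅x, z⁆ from lie_add x y z]
    exact add_mem h1 h2
  · intro r x y _ _ h
    rw [smul_lie]
    exact Submodule.smul_mem _ _ h
  · intro r x y _ _ h
    rw [show ⁅x, r • y⁆ = r • ⁅x, y⁆ from lie_smul r x y]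
    exact Submodule.smul_mem _ _ h

/-- The span is a Lie subalgebra `K` containing the generators. The universal property gives a map
to `K` whose composite with the inclusion fixes the generators, hence is the identity, so `K` is
everything. -/
theorem mem_span_isMonomial (z : ModuleLie A M) :
    z ∈ Submodule.span A {z : ModuleLie A M | ∃ n, IsMonomial A n z} := by
  let K : LieSubalgebra A (ModuleLie A M) :=
    { Submodule.span A {z : ModuleLie A M | ∃ n, IsMonomial A n z} with
      lie_mem' := fun {x y} hx hy => by
        refine Submodule.span_induction₂ (p := fun x y _ _ =>
          ⁅x, y⁆ ∈ Submodule.span A {z : ModuleLie A M | ∃ n, IsMonomial A n z})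
          ?_ ?_ ?_ ?_ ?_ ?_ ?_ hx hy
        · rintro x y ⟨m, hx⟩ ⟨n, hy⟩
          exact Submodule.subset_span ⟨_, hx.lie hy⟩
        · intro x _
          simp
        · intro x _
          rw [show ⁅x, (0 : ModuleLie A M)⁆ = 0 from lie_zero x]
          exact zero_mem _
        · intro x y z _ _ _ h1 h2
          rw [add_lie]
          exact add_mem h1 h2
        · intro x y z _ _ _ h1 h2
          rw [show ⁅x, y + z⁆ = ⁅x, y⁆ + ⁅x, z⁆ from lie_add x y z]
          exact add_mem h1 h2
        · intro r x y _ _ h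
          rw [smul_lie]
          exact Submodule.smul_mem _ _ h
        · intro r x y _ _ h
          rw [show ⁅x, r • y⁆ = r • ⁅x, y⁆ from lie_smul r x y]
          exact Submodule.smul_mem _ _ h }
  have hK (x : M) : ι A x ∈ K := Submodule.subset_span ⟨1, .ι x⟩
  have h : K.incl.comp (lift A ((ι A).codRestrict K.toSubmodule hK)) = LieHom.id :=
    hom_ext fun x => by
      rw [LieHom.comp_apply, lift_ι]
      rfl
  have h' : ((lift A ((ι A).codRestrict K.toSubmodule hK) z : K) : ModuleLie A M) = z :=
    LieHom.congr_fun h z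
  rw [← h']
  exact (lift A ((ι A).codRestrict K.toSubmodule hK) z : K).2

/-- The decomposition of an element of `Lie(M)` into homogeneous components. -/
noncomputable def components : ModuleLie A M →ₗ[A] ℕ →₀ ModuleLie A M :=
  (LieAlgebra.LoopAlgebra.toFinsupp A ℕ (ModuleLie A M)).toLinearMap ∘ₗ
    (lift A (TensorProduct.mk A (AddMonoidAlgebra A ℕ) (ModuleLie A M)
      (AddMonoidAlgebra.single 1 1) ∘ₗ ι A) :
      ModuleLie A M →ₗ⁅A⁆ LieAlgebra.loopAlgebra A ℕ (ModuleLie A M))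

/-- The homomorphism to the loop algebra sends a generator `x` to `t ⊗ x`, so a bracket of `n`
generators acquires the factor `t ^ n`. -/
theorem components_of_isMonomial {n : ℕ} {z : ModuleLie A M} (hz : IsMonomial A n z) :
    components z = Finsupp.single n z := by
  have h : lift A (TensorProduct.mk A (AddMonoidAlgebra A ℕ) (ModuleLie A M)
      (AddMonoidAlgebra.single 1 1) ∘ₗ ι A) z =
        TensorProduct.tmul A (AddMonoidAlgebra.single n (1 : A)) z := by
    induction hz with
    | ι x => simp
    | lie _ _ hx hy =>
      rw [LieHom.map_lie, hx, hy, LieAlgebra.ExtendScalars.bracket_tmul,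
        AddMonoidAlgebra.single_mul_single, one_mul]
  rw [components, LinearMap.comp_apply, LieHom.coe_toLinearMap, h]
  exact LieAlgebra.LoopAlgebra.toFinsupp_single_tmul ..

theorem components_of_mem_degreePart {n : ℕ} {z : ModuleLie A M} (hz : z ∈ degreePart A M n) :
    components z = Finsupp.single n z := by
  induction hz using Submodule.span_induction with
  | mem z hz => exact components_of_isMonomial hz
  | zero => simp
  | add x y _ _ hx hy => rw [map_add, hx, hy, Finsupp.single_add]
  | smul a x _ hx => rw [map_smul, hx, Finsupp.smul_single]

theorem components_mem_degreePart (z : ModuleLie A M) (n : ℕ) :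
    components z n ∈ degreePart A M n := by
  induction mem_span_isMonomial z using Submodule.span_induction with
  | mem z hz =>
    obtain ⟨m, hz⟩ := hz
    rw [components_of_isMonomial hz, Finsupp.single_apply]
    split_ifs with h
    · exact Submodule.subset_span (h ▸ hz)
    · exact zero_mem _
  | zero => simp
  | add x y _ _ hx hy => rw [map_add]; exact add_mem hx hy
  | smul a x _ hx => rw [map_smul]; exact Submodule.smul_mem _ _ hx

/-- The projection of `Lie(M)` to its homogeneous part of degree `n`. -/
noncomputable def proj (n : ℕ) : ModuleLie A M →ₗ[A] degreePart A M n :=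
  (Finsupp.lapply n ∘ₗ components).codRestrict _ fun z => components_mem_degreePart z n

end ModuleLie

namespace LiePlus

open ModuleLie

variable (A M : Type*) [CommRing A] [AddCommGroup M] [Module A M]

/-- The canonical map from `Lie_{≥ 2}(M)` to `Lie(M)`. -/
noncomputable def incl : LiePlus A M →ₗ[A] ModuleLie A M :=
  DirectSum.coeLinearMap fun i => degreePart A M (i + 2)

/-- The projection of `Lie(M)` to `Lie_{≥ 2}(M)`. -/
noncomputable def retraction : ModuleLie A M →ₗ[A] LiePlus A M :=
  Finsupp.lsum A (fun n => match n with
    | 0 => 0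
    | 1 => 0
    | i + 2 => DirectSum.lof A ℕ (fun i => degreePart A M (i + 2)) i ∘ₗ proj (i + 2)) ∘ₗ components

@[simp]
theorem incl_lof (i : ℕ) (y : degreePart A M (i + 2)) :
    incl A M (DirectSum.lof A ℕ (fun i => degreePart A M (i + 2)) i y) = y :=
  DirectSum.coeLinearMap_lof ..

/-- `Lie_{≥ 2}(M)` is thus a direct summand of `Lie(M)`, as the injectivity criterion requires. -/
theorem retraction_comp_incl : retraction A M ∘ₗ incl A M = LinearMap.id := by
  refine DirectSum.linearMap_ext A fun i => LinearMap.ext fun y => ?_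
  rw [LinearMap.comp_apply, LinearMap.comp_apply, incl_lof, retraction, LinearMap.comp_apply,
    components_of_mem_degreePart y.2, Finsupp.lsum_single]
  change DirectSum.lof A ℕ (fun i => degreePart A M (i + 2)) i (proj (i + 2) y.1) =
    DirectSum.lof A ℕ (fun i => degreePart A M (i + 2)) i y
  congr 1
  ext
  change components y.1 (i + 2) = y
  rw [components_of_mem_degreePart y.2, Finsupp.single_eq_same]

end LiePlus

open scoped TensorProduct

/-! ### The Lie algebra `P(A)`, decomposable elements and scalar extension -/

namespace PoissonEnvelope

variable (R A : Type*) [CommRing R] [CommRing A] [Algebra R A]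

/-- The Poisson envelope as a Lie algebra, with the Poisson bracket. -/
def AsLie : Type _ := PoissonEnvelope R A

instance : AddCommGroup (AsLie R A) := inferInstanceAs (AddCommGroup (PoissonEnvelope R A))

noncomputable instance : Module R (AsLie R A) := inferInstanceAs (Module R (PoissonEnvelope R A))

/-- The synonym keeps the Poisson bracket apart from the commutator bracket of the ring `P(A)`,
which is zero. -/
noncomputable instance : LieRing (AsLie R A) where
  bracket x y := (poissonBracket R A).bracket x y
  add_lie x y z := LinearMap.map_add₂ (poissonBracket R A).bracket x y z
  lie_add x y z := map_add ((poissonBracket R A).bracket x) y z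
  lie_self := (poissonBracket R A).bracket_self
  leibniz_lie := (poissonBracket R A).jacobi

noncomputable instance : LieAlgebra R (AsLie R A) where
  lie_smul r x y := map_smul ((poissonBracket R A).bracket x) r y

/-- The identity map from the Poisson envelope to its underlying Lie algebra. -/
noncomputable def toLie : PoissonEnvelope R A ≃ₗ[R] AsLie R A := LinearEquiv.refl R _

variable {R A}

theorem bracket_skew (x y : PoissonEnvelope R A) :
    (poissonBracket R A).bracket x y = -(poissonBracket R A).bracket y x := by
  have h := (poissonBracket R A).bracket_self (x + y)
  simp only [map_add, LinearMap.add_apply, (poissonBracket R A).bracket_self] at h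
  rw [zero_add, add_zero, add_comm] at h
  exact eq_neg_of_add_eq_zero_left h

theorem bracket_mul_left (x y z : PoissonEnvelope R A) :
    (poissonBracket R A).bracket (x * y) z =
      (poissonBracket R A).bracket x z * y + x * (poissonBracket R A).bracket y z := by
  rw [bracket_skew, (poissonBracket R A).leibniz, bracket_skew z x, bracket_skew z y]
  ring

/-! ### The degree parts -/

theorem IsMonomial.smul {n : ℕ} {x : PoissonEnvelope R A} (hx : IsMonomial R n x) (a : A) :
    IsMonomial R n (a • x) := by
  rw [Algebra.smul_def]
  simpa using (IsMonomial.of (R := R) a).mul hx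

theorem IsMonomial.mem {n : ℕ} {x : PoissonEnvelope R A} (hx : IsMonomial R n x) :
    x ∈ degreePart R A n :=
  Submodule.subset_span hx

@[elab_as_elim]
-- No scalar case is needed, because monomials are stable under multiplication by `A`. This matters
-- since the bracket is not `A`-linear.
theorem degreePart_induction {n : ℕ} {p : (x : PoissonEnvelope R A) → x ∈ degreePart R A n → Prop}
    (mem : ∀ x (hx : IsMonomial R n x), p x hx.mem) (zero : p 0 (zero_mem _))
    (add : ∀ x y hx hy, p x hx → p y hy → p (x + y) (add_mem hx hy))
    {x : PoissonEnvelope R A} (hx : x ∈ degreePart R A n) : p x hx := by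
  induction hx using Submodule.closure_induction with
  | zero => exact zero
  | add x y hx hy hpx hpy => exact add x y hx hy hpx hpy
  | smul_mem a x hx => exact mem _ (hx.smul a)

theorem mul_mem_degreePart {m n : ℕ} {x y : PoissonEnvelope R A} (hx : x ∈ degreePart R A m)
    (hy : y ∈ degreePart R A n) : x * y ∈ degreePart R A (m + n) := by
  induction hx using degreePart_induction with
  | mem x hx =>
    induction hy using degreePart_induction with
    | mem y hy => exact (hx.mul hy).mem
    | zero => simp
    | add y z _ _ hy hz => rw [mul_add]; exact add_mem hy hz
  | zero => simp
  | add y z _ _ hy hz => rw [add_mul]; exact add_mem hy hz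

theorem bracket_mem_degreePart {m n : ℕ} {x y : PoissonEnvelope R A} (hx : x ∈ degreePart R A m)
    (hy : y ∈ degreePart R A n) :
    (poissonBracket R A).bracket x y ∈ degreePart R A (m + n + 1) := by
  induction hx using degreePart_induction with
  | mem x hx =>
    induction hy using degreePart_induction with
    | mem y hy => exact (hx.bracket hy).mem
    | zero => simp
    | add y z _ _ hy hz => rw [map_add]; exact add_mem hy hz
  | zero => simp
  | add y z _ _ hy hz => rw [LinearMap.map_add₂]; exact add_mem hy hz

theorem algebraMap_mem_degreePart (a : A) :
    algebraMap A (PoissonEnvelope R A) a ∈ degreePart R A 0 :=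
  (IsMonomial.of a).mem

theorem prod_mem_degreePart {k : ℕ} (n : Fin k → ℕ) (x : Fin k → PoissonEnvelope R A)
    (hx : ∀ j, x j ∈ degreePart R A (n j)) : ∏ j, x j ∈ degreePart R A (∑ j, n j) := by
  induction k with
  | zero => simpa using algebraMap_mem_degreePart (R := R) (1 : A)
  | succ k ih =>
    rw [Fin.prod_univ_succ, Fin.sum_univ_succ]
    exact mul_mem_degreePart (hx 0) (ih _ _ fun j => hx j.succ)

variable (R A) in
/-- The part of `P^n(A)` spanned by products of two elements of positive degree. -/
def decomposables (n : ℕ) : Submodule A (PoissonEnvelope R A) :=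
  Submodule.span A {z | ∃ e f x y, e + f + 2 = n ∧ x ∈ degreePart R A (e + 1) ∧
    y ∈ degreePart R A (f + 1) ∧ z = x * y}

theorem mul_mem_decomposables {m n d : ℕ} {x y : PoissonEnvelope R A}
    (hx : x ∈ degreePart R A m) (hy : y ∈ degreePart R A n) (hm : m ≠ 0) (hn : n ≠ 0)
    (hd : m + n = d) : x * y ∈ decomposables R A d := by
  obtain ⟨m, rfl⟩ := Nat.exists_eq_succ_of_ne_zero hm
  obtain ⟨n, rfl⟩ := Nat.exists_eq_succ_of_ne_zero hn
  exact Submodule.subset_span ⟨m, n, x, y, by omega, hx, hy, rfl⟩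

theorem bracket_mem_decomposables {m n : ℕ} {u z : PoissonEnvelope R A}
    (hu : u ∈ degreePart R A m) (hz : z ∈ decomposables R A n) :
    (poissonBracket R A).bracket u z ∈ decomposables R A (m + n + 1) := by
  induction hz using Submodule.closure_induction with
  | zero => simp
  | add x y _ _ hx hy => rw [map_add]; exact add_mem hx hy
  | smul_mem a z hz =>
    obtain ⟨e, f, x, y, h, hx, hy, rfl⟩ := hz
    -- The scalar is absorbed into the first factor before the Leibniz rule is applied.
    have hx' := Submodule.smul_mem _ a hx
    rw [← smul_mul_assoc, (poissonBracket R A).leibniz]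
    exact add_mem
      (mul_mem_decomposables (bracket_mem_degreePart hu hx') hy (by omega) (by omega) (by omega))
      (mul_mem_decomposables hx' (bracket_mem_degreePart hu hy) (by omega) (by omega) (by omega))

theorem bracket_mem_decomposables' {m n : ℕ} {u z : PoissonEnvelope R A}
    (hu : u ∈ degreePart R A m) (hz : z ∈ decomposables R A n) :
    (poissonBracket R A).bracket z u ∈ decomposables R A (n + m + 1) := by
  rw [bracket_skew, add_comm n]
  exact neg_mem (bracket_mem_decomposables hu hz)

/-! ### The extension of scalars of the Lie algebra `P(A)` -/

variable (R A) in
/-- The extension of scalars of the Lie algebra `P(A)`. -/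
def ExtendedLie : Type _ := A ⊗[R] AsLie R A

noncomputable instance : LieRing (ExtendedLie R A) := inferInstanceAs (LieRing (A ⊗[R] AsLie R A))

noncomputable instance : LieAlgebra A (ExtendedLie R A) :=
  inferInstanceAs (LieAlgebra A (A ⊗[R] AsLie R A))

namespace ExtendedLie

/-- The pure tensors in the extension of scalars of `P(A)`. -/
noncomputable def tmul (c : A) (x : PoissonEnvelope R A) : ExtendedLie R A :=
  TensorProduct.tmul R c (toLie R A x)

theorem lie_tmul (c e : A) (x y : PoissonEnvelope R A) :
    ⁅tmul c x, tmul e y⁆ = tmul (c * e) ((poissonBracket R A).bracket x y) := rfl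

theorem smul_tmul (c e : A) (x : PoissonEnvelope R A) : c • tmul e x = tmul (c • e) x := rfl

@[elab_as_elim]
theorem induction {p : ExtendedLie R A → Prop} (tmul : ∀ c x, p (tmul c x)) (zero : p 0)
    (add : ∀ s t, p s → p t → p (s + t)) (s : ExtendedLie R A) : p s :=
  TensorProduct.induction_on s zero tmul add

/-- The linear map from the extension of scalars of `P(A)` which extends an `R`-linear map. -/
noncomputable def lift {N : Type*} [AddCommGroup N] [Module A N] [Module R N]
    [IsScalarTower R A N] (f : PoissonEnvelope R A →ₗ[R] N) : ExtendedLie R A →ₗ[A] N :=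
  LinearMap.liftBaseChange A (f ∘ₗ (toLie R A).symm.toLinearMap)

@[simp]
theorem lift_tmul {N : Type*} [AddCommGroup N] [Module A N] [Module R N]
    [IsScalarTower R A N] (f : PoissonEnvelope R A →ₗ[R] N) (c : A) (x : PoissonEnvelope R A) :
    lift f (tmul c x) = c • f x := rfl

end ExtendedLie

variable (R A) in
/-- The multiplication map from the extension of scalars of `P(A)` to `P(A)`. -/
noncomputable def scalarMul : ExtendedLie R A →ₗ[A] PoissonEnvelope R A :=
  ExtendedLie.lift LinearMap.id

@[simp]
theorem scalarMul_tmul (c : A) (x : PoissonEnvelope R A) :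
    scalarMul R A (.tmul c x) = c • x := rfl

variable (R A) in
/-- The part of the extension of scalars of `P(A)` generated by `P^n(A)`. -/
noncomputable def extendedPart (n : ℕ) : Submodule A (ExtendedLie R A) :=
  Submodule.span A {s | ∃ x, IsMonomial R n x ∧ s = ExtendedLie.tmul 1 x}

theorem tmul_mem_extendedPart {n : ℕ} (c : A) {x : PoissonEnvelope R A} (hx : IsMonomial R n x) :
    ExtendedLie.tmul c x ∈ extendedPart R A n := by
  rw [← mul_one c, ← smul_eq_mul, ← ExtendedLie.smul_tmul]
  exact Submodule.smul_mem _ _ (Submodule.subset_span ⟨x, hx, rfl⟩)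

@[elab_as_elim]
theorem extendedPart_induction {n : ℕ}
    {p : (s : ExtendedLie R A) → s ∈ extendedPart R A n → Prop}
    (mem : ∀ (c : A) x (hx : IsMonomial R n x), p (.tmul c x) (tmul_mem_extendedPart c hx))
    (zero : p 0 (zero_mem _)) (add : ∀ s t hs ht, p s hs → p t ht → p (s + t) (add_mem hs ht))
    {s : ExtendedLie R A} (hs : s ∈ extendedPart R A n) : p s hs := by
  induction hs using Submodule.closure_induction with
  | zero => exact zero
  | add x y hx hy hpx hpy => exact add x y hx hy hpx hpy
  | smul_mem a x hx =>
    obtain ⟨x, hx, rfl⟩ := hx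
    simp only [ExtendedLie.smul_tmul, smul_eq_mul, mul_one]
    exact mem a x hx

theorem lie_mem_extendedPart {m n : ℕ} {s t : ExtendedLie R A} (hs : s ∈ extendedPart R A m)
    (ht : t ∈ extendedPart R A n) : ⁅s, t⁆ ∈ extendedPart R A (m + n + 1) := by
  refine Submodule.span_induction₂ (p := fun s t _ _ => ⁅s, t⁆ ∈ extendedPart R A (m + n + 1))
    ?_ ?_ ?_ ?_ ?_ ?_ ?_ hs ht
  · rintro _ _ ⟨x, hx, rfl⟩ ⟨y, hy, rfl⟩
    rw [ExtendedLie.lie_tmul, one_mul]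
    exact Submodule.subset_span ⟨_, hx.bracket hy, rfl⟩
  · intro t _
    rw [zero_lie]
    exact zero_mem _
  · intro s _
    rw [lie_zero]
    exact zero_mem _
  · intro x y z _ _ _ h1 h2
    rw [add_lie]
    exact add_mem h1 h2
  · intro x y z _ _ _ h1 h2
    rw [lie_add]
    exact add_mem h1 h2
  · intro r x y _ _ h
    rw [smul_lie]
    exact Submodule.smul_mem _ _ h
  · intro r x y _ _ h
    rw [lie_smul]
    exact Submodule.smul_mem _ _ h

theorem scalarMul_mem {n : ℕ} {s : ExtendedLie R A} (hs : s ∈ extendedPart R A n) :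
    scalarMul R A s ∈ degreePart R A n := by
  induction hs using extendedPart_induction with
  | mem c x hx => exact Submodule.smul_mem _ _ hx.mem
  | zero => simp
  | add s t _ _ hs ht => rw [map_add]; exact add_mem hs ht

/-- The multiplication map is compatible with brackets modulo decomposable elements. -/
theorem bracket_scalarMul_sub_mem {m n : ℕ} (hm : m ≠ 0) (hn : n ≠ 0) {s t : ExtendedLie R A}
    (hs : s ∈ extendedPart R A m) (ht : t ∈ extendedPart R A n) :
    (poissonBracket R A).bracket (scalarMul R A s) (scalarMul R A t) - scalarMul R A ⁅s, t⁆ ∈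
      decomposables R A (m + n + 1) := by
  induction hs using extendedPart_induction with
  | zero => simp
  | add s s' _ _ hs hs' =>
    rw [map_add, LinearMap.map_add₂, add_lie, map_add, add_sub_add_comm]
    exact add_mem hs hs'
  | mem c x hx =>
    induction ht using extendedPart_induction with
    | zero => simp
    | add s s' _ _ hs hs' =>
      rw [map_add, map_add, lie_add, map_add, add_sub_add_comm]
      exact add_mem hs hs'
    | mem e y hy =>
      rw [ExtendedLie.lie_tmul, scalarMul_tmul, scalarMul_tmul,
        scalarMul_tmul]
      replace hx := hx.mem
      replace hy := hy.mem
      set b := (poissonBracket R A).bracket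
      set c' := algebraMap A (PoissonEnvelope R A) c with hc
      set e' := algebraMap A (PoissonEnvelope R A) e with he
      have hc' : c' ∈ degreePart R A 0 := algebraMap_mem_degreePart c
      have he' : e' ∈ degreePart R A 0 := algebraMap_mem_degreePart e
      -- The error consists of the terms in which a scalar is differentiated. The remaining factors
      -- `y`, `x` and `x * y` have positive degree because `m` and `n` are nonzero.
      have key : b (c • x) (e • y) - (c * e) • b x y =
          c • (b x e' * y) + e • (b c' y * x) + b c' e' * (x * y) := by
        simp only [Algebra.smul_def, map_mul, ← hc, ← he]
        rw [bracket_mul_left, (poissonBracket R A).leibniz, (poissonBracket R A).leibniz]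
        ring
      rw [key]
      refine add_mem (add_mem (Submodule.smul_mem _ _ ?_) (Submodule.smul_mem _ _ ?_)) ?_
      · exact mul_mem_decomposables (bracket_mem_degreePart hx he') hy (by omega) hn (by omega)
      · exact mul_mem_decomposables (bracket_mem_degreePart hc' hy) hx (by omega) hm (by omega)
      · exact mul_mem_decomposables (bracket_mem_degreePart hc' he') (mul_mem_degreePart hx hy)
          (by omega) (by omega) (by omega)

/-- Bracket with a fixed element of `P(A)`, as a derivation of `A`. -/
noncomputable def bracketDerivation (x : PoissonEnvelope R A) :
    Derivation R A (PoissonEnvelope R A) :=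
  Derivation.mk' ((poissonBracket R A).bracket.flip x ∘ₗ
    (IsScalarTower.toAlgHom R A (PoissonEnvelope R A)).toLinearMap) fun a b => by
      simp only [LinearMap.comp_apply, AlgHom.toLinearMap_apply, LinearMap.flip_apply, map_mul,
        IsScalarTower.coe_toAlgHom', bracket_mul_left, Algebra.smul_def]
      ring

theorem bracketDerivation_apply (x : PoissonEnvelope R A) (a : A) :
    bracketDerivation x a =
      (poissonBracket R A).bracket (algebraMap A (PoissonEnvelope R A) a) x := rfl

end PoissonEnvelope

/-! ### From Kähler differentials to the Poisson envelope -/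

/-- A section of the presentation of the Kähler differentials by the free module on `A` computes
all derivations. -/
theorem KaehlerDifferential.linearCombination_section {R A N : Type*} [CommRing R] [CommRing A]
    [Algebra R A] [AddCommGroup N] [Module R N] [Module A N] [IsScalarTower R A N]
    {τ : KaehlerDifferential R A →ₗ[A] A →₀ A}
    (hτ : Finsupp.linearCombination A (KaehlerDifferential.D R A) ∘ₗ τ = LinearMap.id)
    (δ : Derivation R A N) (ω : KaehlerDifferential R A) :
    Finsupp.linearCombination A δ (τ ω) = δ.liftKaehlerDifferential ω := by
  conv_rhs => rw [← LinearMap.id_apply (R := A) ω, ← hτ, LinearMap.comp_apply,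
    Finsupp.apply_linearCombination]
  congr 2
  ext a
  simp

namespace PoissonEnvelope

open ModuleLie

variable {R A : Type*} [CommRing R] [CommRing A] [Algebra R A]
  (τ : KaehlerDifferential R A →ₗ[A] A →₀ A)

/-- The Lie homomorphism from `Lie(Ω)` to the extension of scalars of `P(A)` which is determined
by a lift of differential forms to formal combinations of elements of `A`. -/
noncomputable def lieHom : ModuleLie A (KaehlerDifferential R A) →ₗ⁅A⁆ ExtendedLie R A :=
  ModuleLie.lift A (Finsupp.linearCombination A
    (fun b => ExtendedLie.tmul (1 : A) (algebraMap A (PoissonEnvelope R A) b)) ∘ₗ τ)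

theorem lieHom_ι (ω : KaehlerDifferential R A) :
    lieHom τ (ι A ω) = Finsupp.linearCombination A
      (fun b => ExtendedLie.tmul (1 : A) (algebraMap A (PoissonEnvelope R A) b)) (τ ω) :=
  ModuleLie.lift_ι _ _

/-- The shift by one arises because an iterated bracket of `n` generators contains `n - 1` brackets.
-/
theorem lieHom_mem_of_isMonomial {n : ℕ} {z : ModuleLie A (KaehlerDifferential R A)}
    (hz : ModuleLie.IsMonomial A n z) : ∃ m, n = m + 1 ∧ lieHom τ z ∈ extendedPart R A m := by
  induction hz with
  | ι ω =>
    refine ⟨0, rfl, ?_⟩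
    rw [lieHom_ι, Finsupp.linearCombination_apply]
    exact sum_mem fun b _ => Submodule.smul_mem _ _ (Submodule.subset_span ⟨_, .of b, rfl⟩)
  | lie _ _ hx hy =>
    obtain ⟨m, rfl, hx⟩ := hx
    obtain ⟨n, rfl, hy⟩ := hy
    refine ⟨m + n + 1, by omega, ?_⟩
    rw [LieHom.map_lie]
    exact lie_mem_extendedPart hx hy

theorem lieHom_mem {n : ℕ} {z : ModuleLie A (KaehlerDifferential R A)}
    (hz : z ∈ ModuleLie.degreePart A (KaehlerDifferential R A) (n + 1)) :
    lieHom τ z ∈ extendedPart R A n := by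
  induction hz using Submodule.span_induction with
  | mem z hz =>
    obtain ⟨m, h, hz⟩ := lieHom_mem_of_isMonomial τ hz
    rwa [Nat.succ_injective h]
  | zero => simp
  | add x y _ _ hx hy => rw [map_add]; exact add_mem hx hy
  | smul a x _ hx => rw [map_smul]; exact Submodule.smul_mem _ _ hx

/-- The linear map from `Lie(Ω)` to `P(A)` which is determined by a lift of differential forms to
formal combinations of elements of `A`. -/
noncomputable def lieMap : ModuleLie A (KaehlerDifferential R A) →ₗ[A] PoissonEnvelope R A :=
  scalarMul R A ∘ₗ (lieHom τ : ModuleLie A (KaehlerDifferential R A) →ₗ[A] ExtendedLie R A)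

theorem lieMap_apply (z : ModuleLie A (KaehlerDifferential R A)) :
    lieMap τ z = scalarMul R A (lieHom τ z) := rfl

theorem lieMap_mem {n : ℕ} {z : ModuleLie A (KaehlerDifferential R A)}
    (hz : z ∈ ModuleLie.degreePart A (KaehlerDifferential R A) (n + 1)) :
    lieMap τ z ∈ degreePart R A n :=
  scalarMul_mem (lieHom_mem τ hz)

variable {τ}

/-- The left side is `c` times `∑ τ(da)_b {b, x}`, and this sum is the derivation `{-, x}` evaluated
at `a` by way of the section. So the identity is exact, with no decomposable error. -/
theorem scalarMul_lie_lieHom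
    (hτ : Finsupp.linearCombination A (KaehlerDifferential.D R A) ∘ₗ τ = LinearMap.id)
    (a c : A) (x : PoissonEnvelope R A) :
    scalarMul R A ⁅lieHom τ (ι A (KaehlerDifferential.D R A a)), ExtendedLie.tmul c x⁆ =
      c • (poissonBracket R A).bracket (algebraMap A (PoissonEnvelope R A) a) x := by
  have h := KaehlerDifferential.linearCombination_section hτ (c • bracketDerivation x)
    (KaehlerDifferential.D R A a)
  rw [Derivation.liftKaehlerDifferential_comp_D, Derivation.smul_apply,
    bracketDerivation_apply] at h
  rw [lieHom_ι, ← h, Finsupp.linearCombination_apply, Finsupp.linearCombination_apply, Finsupp.sum,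
    Finsupp.sum, sum_lie, map_sum]
  refine Finset.sum_congr rfl fun b _ => ?_
  rw [smul_lie, map_smul, ExtendedLie.lie_tmul, one_mul,
    scalarMul_tmul]
  rfl

/-- This covers the bracket of two elements of degree zero, where an error term could not be
absorbed into decomposables. The section property is applied once in each argument. -/
theorem lieMap_lie_D
    (hτ : Finsupp.linearCombination A (KaehlerDifferential.D R A) ∘ₗ τ = LinearMap.id) (a b : A) :
    lieMap τ ⁅ι A (KaehlerDifferential.D R A a), ι A (KaehlerDifferential.D R A b)⁆ =
      (poissonBracket R A).bracket (algebraMap A _ a) (algebraMap A _ b) := by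
  have h := KaehlerDifferential.linearCombination_section hτ
    (bracketDerivation (algebraMap A (PoissonEnvelope R A) a)) (KaehlerDifferential.D R A b)
  rw [Derivation.liftKaehlerDifferential_comp_D, bracketDerivation_apply] at h
  rw [bracket_skew, ← h, lieMap_apply, LieHom.map_lie, lieHom_ι τ (KaehlerDifferential.D R A b),
    Finsupp.linearCombination_apply, Finsupp.linearCombination_apply, Finsupp.sum,
    Finsupp.sum, lie_sum, map_sum, ← Finset.sum_neg_distrib]
  refine Finset.sum_congr rfl fun c _ => ?_
  rw [lie_smul, map_smul, scalarMul_lie_lieHom hτ, one_smul, bracketDerivation_apply, ← smul_neg,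
    ← bracket_skew]

/-- This is the mixed case left out by `bracket_scalarMul_sub_mem`, with one argument of degree
zero. On `c ⊗ x` the error is `{a, c} x`, decomposable because `x` has positive degree. -/
theorem bracket_lieMap_sub_mem
    (hτ : Finsupp.linearCombination A (KaehlerDifferential.D R A) ∘ₗ τ = LinearMap.id) (a : A)
    {n : ℕ} (hn : n ≠ 0) {z : ModuleLie A (KaehlerDifferential R A)}
    (hz : z ∈ ModuleLie.degreePart A (KaehlerDifferential R A) (n + 1)) :
    (poissonBracket R A).bracket (algebraMap A _ a) (lieMap τ z) -
      lieMap τ ⁅ι A (KaehlerDifferential.D R A a), z⁆ ∈ decomposables R A (n + 1) := by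
  rw [lieMap_apply, lieMap_apply, LieHom.map_lie]
  have hs := lieHom_mem τ hz
  generalize lieHom τ z = s at hs ⊢
  induction hs using extendedPart_induction with
  | zero => simp
  | add s s' _ _ hs hs' =>
    rw [map_add, map_add, lie_add, map_add, add_sub_add_comm]
    exact add_mem hs hs'
  | mem c x hx =>
    rw [scalarMul_lie_lieHom hτ, scalarMul_tmul, Algebra.smul_def, (poissonBracket R A).leibniz,
      Algebra.smul_def, add_sub_cancel_right]
    exact mul_mem_decomposables (bracket_mem_degreePart (algebraMap_mem_degreePart a)
      (algebraMap_mem_degreePart c)) hx.mem (by omega) hn (by omega)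

end PoissonEnvelope

/-! ### A first-order criterion for injectivity -/

namespace SymmetricAlgebra

/-- A homomorphism from the symmetric algebra of a direct summand `N` of `M` is injective if it
can be corrected, in each nilpotent thickening, to the inclusion to first order. -/
theorem injective_of_forall_exists {A M N B : Type*} [CommRing A] [AddCommGroup M] [Module A M]
    [AddCommGroup N] [Module A N] [CommRing B] [Algebra A B] (i : N →ₗ[A] M) (r : M →ₗ[A] N)
    (hri : r ∘ₗ i = LinearMap.id) (ψ : SymmetricAlgebra A N →ₐ[A] B)
    (h : ∀ k, 2 ≤ k → ∃ Φ : B →+* SymmetricAlgebra A M ⧸ augIdeal A M ^ k,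
      (∀ a, ∃ w, Φ (algebraMap A B a) = Ideal.Quotient.mk _ w ∧
        w - algebraMap A _ a ∈ augIdeal A M) ∧
      ∀ y, ∃ w, Φ (ψ (ι A N y)) = Ideal.Quotient.mk _ w ∧ w - ι A M (i y) ∈ augIdeal A M ^ 2) :
    Function.Injective ψ := by
  let incl : SymmetricAlgebra A N →ₐ[A] SymmetricAlgebra A M := lift (ι A M ∘ₗ i)
  let retr : SymmetricAlgebra A M →ₐ[A] SymmetricAlgebra A N := lift (ι A N ∘ₗ r)
  have hincl (y : N) : incl (ι A N y) = ι A M (i y) := by simp [incl]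
  have hretr (z : M) : retr (ι A M z) = ι A N (r z) := by simp [retr]
  have hcomp : retr.comp incl = AlgHom.id A _ := by
    refine algHom_ext (LinearMap.ext fun y => ?_)
    have := congr($hri y)
    rw [LinearMap.comp_apply, LinearMap.id_apply] at this
    simp [hincl, hretr, this]
  rw [injective_iff_map_eq_zero]
  intro q hq
  refine eq_zero_of_forall_mem_augIdeal_pow fun j => ?_
  induction j with
  | zero => simp
  | succ j ih =>
    -- The exponent `j + 2` is at least 2 and large enough for membership in the power `j + 1` to be
    -- detected in the quotient. Since `Φ (ψ q) = 0`, the first-order comparison puts `incl q` in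
    -- that power, and the retraction returns this to `q`.
    obtain ⟨Φ, hof, hι⟩ := h (j + 2) (Nat.le_add_left 2 j)
    let mk := Ideal.Quotient.mk (augIdeal A M ^ (j + 2))
    have h1 := (sub_mem_pow_of_mem_augIdeal_pow (Φ.comp ψ.toRingHom)
      (mk.comp incl.toRingHom) ((augIdeal A M).map mk)
      (fun a => by
        obtain ⟨w, hw, hw'⟩ := hof a
        have := Ideal.mem_map_of_mem mk hw'
        simpa [hw, mk] using this)
      (fun y => by
        obtain ⟨w, hw, hw'⟩ := hι y
        have := Ideal.mem_map_of_mem mk hw'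
        rw [Ideal.map_pow] at this
        simpa [hw, hincl, mk] using this)
      (fun y => by
        have := Ideal.mem_map_of_mem mk (ι_mem_augIdeal (i y))
        simpa [hincl] using this) ih).1
    have h2 : mk (incl q) ∈ (augIdeal A M ^ (j + 1)).map mk := by
      rw [Ideal.map_pow]
      simpa [hq] using h1
    rw [Ideal.mem_quotient_iff_mem (Ideal.pow_le_pow_right (Nat.le_succ (j + 1)))] at h2
    have h3 := map_augIdeal_pow_le retr (augIdeal A N)
      (fun z => by rw [hretr]; exact ι_mem_augIdeal _) h2
    rwa [show retr (incl q) = q from congr($hcomp q)] at h3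

end SymmetricAlgebra

/-! ### Multiplicativity of the graded pieces `QPart` -/

namespace QPart

variable {A M : Type*} [CommRing A] [AddCommGroup M] [Module A M]

/-- Bundling each index with its element lets two families be concatenated by `Fin.append` without
dependent types. -/
theorem mem_iff_span (d : ℕ) : QPart A M d = Submodule.span A
    {z | ∃ (k : ℕ) (Y : Fin k → Σ i, ModuleLie.degreePart A M (i + 2)), ∑ j, ((Y j).1 + 1) = d ∧
      z = ∏ j, SymmetricAlgebra.ι A (LiePlus A M)
        (DirectSum.lof A ℕ (fun i => ModuleLie.degreePart A M (i + 2)) (Y j).1 (Y j).2)} := by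
  refine congrArg _ (Set.ext fun z => ⟨?_, ?_⟩)
  · rintro ⟨k, n, y, h, rfl⟩
    exact ⟨k, fun j => ⟨n j, y j⟩, h, rfl⟩
  · rintro ⟨k, Y, h, rfl⟩
    exact ⟨k, fun j => (Y j).1, fun j => (Y j).2, h, rfl⟩

theorem one_mem : (1 : SymmetricAlgebra A (LiePlus A M)) ∈ QPart A M 0 :=
  Submodule.subset_span ⟨0, Fin.elim0, fun j => j.elim0, by simp, by simp⟩

theorem ι_mem {i : ℕ} (y : ModuleLie.degreePart A M (i + 2)) :
    SymmetricAlgebra.ι A (LiePlus A M)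
      (DirectSum.lof A ℕ (fun i => ModuleLie.degreePart A M (i + 2)) i y) ∈ QPart A M (i + 1) :=
  Submodule.subset_span ⟨1, fun _ => i, fun _ => y, by simp, by simp⟩

theorem mul_mem {m n : ℕ} {x y : SymmetricAlgebra A (LiePlus A M)} (hx : x ∈ QPart A M m)
    (hy : y ∈ QPart A M n) : x * y ∈ QPart A M (m + n) := by
  rw [mem_iff_span] at hx hy ⊢
  have h := Submodule.mul_mem_mul hx hy
  rw [Submodule.span_mul_span] at h
  refine Submodule.span_mono ?_ h
  rintro _ ⟨_, ⟨k, Y, rfl, rfl⟩, _, ⟨l, Z, rfl, rfl⟩, rfl⟩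
  refine ⟨k + l, Fin.append Y Z, by simp [Fin.sum_univ_add], ?_⟩
  rw [Fin.prod_univ_add]
  exact congrArg₂ _ (Finset.prod_congr rfl fun i _ => by rw [Fin.append_left])
    (Finset.prod_congr rfl fun i _ => by rw [Fin.append_right])

end QPart

/-! ### The comparison map and its image -/

namespace PoissonEnvelope

open ModuleLie

variable {R A : Type*} [CommRing R] [CommRing A] [Algebra R A]
  {τ : KaehlerDifferential R A →ₗ[A] A →₀ A}

/-- Modulo decomposable elements, the homogeneous part of positive degree of `P(A)` is the image
of the free Lie algebra. -/
theorem mem_of_isMonomial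
    (hτ : Finsupp.linearCombination A (KaehlerDifferential.D R A) ∘ₗ τ = LinearMap.id) {d : ℕ}
    {x : PoissonEnvelope R A} (hx : IsMonomial R d x) :
    (d = 0 → ∃ a, x = algebraMap A _ a) ∧ (d ≠ 0 →
      ∃ z ∈ ModuleLie.degreePart A (KaehlerDifferential R A) (d + 1),
        x - lieMap τ z ∈ decomposables R A d) := by
  have hD (a : A) : ι A (KaehlerDifferential.D R A a) ∈
      ModuleLie.degreePart A (KaehlerDifferential R A) 1 := Submodule.subset_span (.ι _)
  have hlie {m n} {u v : ModuleLie A (KaehlerDifferential R A)}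
      (hu : u ∈ ModuleLie.degreePart A (KaehlerDifferential R A) m)
      (hv : v ∈ ModuleLie.degreePart A (KaehlerDifferential R A) n) :
      ⁅u, v⁆ ∈ ModuleLie.degreePart A (KaehlerDifferential R A) (m + n) :=
    ModuleLie.lie_mem_degreePart hu hv
  have hleft (a : A) {n : ℕ} (hn : n ≠ 0) {y : PoissonEnvelope R A}
      (hy : ∃ z ∈ ModuleLie.degreePart A (KaehlerDifferential R A) (n + 1),
        y - lieMap τ z ∈ decomposables R A n) :
      ∃ z ∈ ModuleLie.degreePart A (KaehlerDifferential R A) (n + 1 + 1),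
        (poissonBracket R A).bracket (algebraMap A _ a) y - lieMap τ z ∈
          decomposables R A (n + 1) := by
    obtain ⟨v, hv, hyv⟩ := hy
    refine ⟨⁅ι A (KaehlerDifferential.D R A a), v⁆, add_comm 1 (n + 1) ▸ hlie (hD a) hv, ?_⟩
    have h1 := bracket_mem_decomposables (algebraMap_mem_degreePart (R := R) a) hyv
    rw [zero_add, map_sub] at h1
    have := add_mem h1 (bracket_lieMap_sub_mem hτ a hn hv)
    rwa [sub_add_sub_cancel] at this
  induction hx with
  | of a => exact ⟨fun _ => ⟨a, rfl⟩, fun h => absurd rfl h⟩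
  | @mul m n x y hx hy ihx ihy =>
    refine ⟨fun h => ?_, fun h => ?_⟩
    · obtain ⟨a, rfl⟩ := ihx.1 (by omega)
      obtain ⟨b, rfl⟩ := ihy.1 (by omega)
      exact ⟨a * b, (map_mul _ _ _).symm⟩
    · by_cases hm : m = 0
      · subst hm
        obtain ⟨a, rfl⟩ := ihx.1 rfl
        rw [zero_add] at h ⊢
        obtain ⟨z, hz, hyz⟩ := ihy.2 h
        refine ⟨a • z, Submodule.smul_mem _ _ hz, ?_⟩
        rw [← Algebra.smul_def, map_smul, ← smul_sub]
        exact Submodule.smul_mem _ _ hyz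
      by_cases hn : n = 0
      · subst hn
        obtain ⟨a, rfl⟩ := ihy.1 rfl
        obtain ⟨z, hz, hxz⟩ := ihx.2 hm
        refine ⟨a • z, Submodule.smul_mem _ _ hz, ?_⟩
        rw [mul_comm, ← Algebra.smul_def, map_smul, ← smul_sub]
        exact Submodule.smul_mem _ _ hxz
      -- Both factors now have positive degree, so the product is itself decomposable.
      refine ⟨0, zero_mem _, ?_⟩
      rw [map_zero, sub_zero]
      exact mul_mem_decomposables hx.mem hy.mem hm hn rfl
  | @bracket m n x y hx hy ihx ihy =>
    refine ⟨fun h => absurd h (by omega), fun _ => ?_⟩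
    by_cases hm : m = 0
    · subst hm
      obtain ⟨a, rfl⟩ := ihx.1 rfl
      by_cases hn : n = 0
      · subst hn
        obtain ⟨b, rfl⟩ := ihy.1 rfl
        refine ⟨⁅ι A (KaehlerDifferential.D R A a), ι A (KaehlerDifferential.D R A b)⁆,
          hlie (hD a) (hD b), ?_⟩
        rw [lieMap_lie_D hτ, sub_self]
        exact zero_mem _
      rw [zero_add]
      exact hleft a hn (ihy.2 hn)
    by_cases hn : n = 0
    · subst hn
      obtain ⟨b, rfl⟩ := ihy.1 rfl
      obtain ⟨z, hz, h⟩ := hleft b hm (ihx.2 hm)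
      refine ⟨-z, neg_mem hz, ?_⟩
      rw [bracket_skew, map_neg, sub_neg_eq_add, neg_add_eq_sub, ← neg_sub]
      exact neg_mem h
    obtain ⟨u, hu, hxu⟩ := ihx.2 hm
    obtain ⟨v, hv, hyv⟩ := ihy.2 hn
    refine ⟨⁅u, v⁆, ?_, ?_⟩
    · rw [show m + n + 1 + 1 = m + 1 + (n + 1) by omega]
      exact hlie hu hv
    have h1 := bracket_scalarMul_sub_mem hm hn (lieHom_mem τ hu) (lieHom_mem τ hv)
    rw [← LieHom.map_lie, ← lieMap_apply, ← lieMap_apply, ← lieMap_apply] at h1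
    have h2 := bracket_mem_decomposables' hy.mem hxu
    have h3 := bracket_mem_decomposables (lieMap_mem τ hu) hyv
    -- With `u'`, `v'` the images of `u`, `v`, the error is `{x - u', y} + {u', y - v'}` plus the
    -- defect of `lieMap` on `⁅u, v⁆`.
    have := add_mem (add_mem h2 h3) h1
    simpa using this

variable (τ) in
/-- The homomorphism of `A`-algebras from the symmetric algebra of `Lie_{≥ 2}(Ω)` to `P(A)`. -/
noncomputable def symmetricMap :
    SymmetricAlgebra A (LiePlus A (KaehlerDifferential R A)) →ₐ[A] PoissonEnvelope R A :=
  SymmetricAlgebra.lift (lieMap τ ∘ₗ LiePlus.incl A (KaehlerDifferential R A))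

theorem symmetricMap_ι (y : LiePlus A (KaehlerDifferential R A)) :
    symmetricMap τ (SymmetricAlgebra.ι A _ y) = lieMap τ (LiePlus.incl A _ y) := by
  simp [symmetricMap]

theorem map_symmetricMap_le (d : ℕ) :
    (QPart A (KaehlerDifferential R A) d).map (symmetricMap τ).toLinearMap ≤
      degreePart R A d := by
  rw [QPart, Submodule.map_span_le]
  rintro _ ⟨k, n, y, rfl, rfl⟩
  rw [AlgHom.toLinearMap_apply, map_prod]
  refine prod_mem_degreePart _ _ fun j => ?_
  rw [symmetricMap_ι, LiePlus.incl_lof]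
  exact lieMap_mem τ (y j).2

/-- Strong induction on `d`: both factors of a decomposable element have smaller degree, and
`mem_of_isMonomial` reduces everything else to the image of `Lie^{d + 1}(Ω)`. -/
theorem map_symmetricMap
    (hτ : Finsupp.linearCombination A (KaehlerDifferential.D R A) ∘ₗ τ = LinearMap.id) (d : ℕ) :
    (QPart A (KaehlerDifferential R A) d).map (symmetricMap τ).toLinearMap =
      degreePart R A d := by
  refine le_antisymm (map_symmetricMap_le d) ?_
  induction d using Nat.strong_induction_on with
  | _ d ih =>
    refine Submodule.span_le.2 fun x hx => ?_
    by_cases hd : d = 0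
    · subst hd
      obtain ⟨a, rfl⟩ := (mem_of_isMonomial hτ hx).1 rfl
      exact ⟨a • 1, Submodule.smul_mem _ _ QPart.one_mem, by simp [Algebra.algebraMap_eq_smul_one]⟩
    · obtain ⟨z, hz, hxz⟩ := (mem_of_isMonomial hτ hx).2 hd
      obtain ⟨n, rfl⟩ := Nat.exists_eq_succ_of_ne_zero hd
      have hdec : decomposables R A (n + 1) ≤
          (QPart A (KaehlerDifferential R A) (n + 1)).map (symmetricMap τ).toLinearMap := by
        refine Submodule.span_le.2 ?_
        rintro _ ⟨e, f, x, y, h, hx, hy, rfl⟩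
        obtain ⟨q, hq, rfl⟩ := ih (e + 1) (by omega) hx
        obtain ⟨r, hr, rfl⟩ := ih (f + 1) (by omega) hy
        refine ⟨q * r, ?_, map_mul (symmetricMap τ) q r⟩
        have := QPart.mul_mem hq hr
        rwa [show e + 1 + (f + 1) = n + 1 by omega] at this
      have hz' : lieMap τ z ∈
          (QPart A (KaehlerDifferential R A) (n + 1)).map (symmetricMap τ).toLinearMap :=
        ⟨_, QPart.ι_mem ⟨z, hz⟩, by
          rw [AlgHom.toLinearMap_apply, symmetricMap_ι, LiePlus.incl_lof]⟩
      have := add_mem (hdec hxz) hz'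
      rwa [sub_add_cancel] at this

/-! ### Injectivity -/

/-- The component `δ` of degree one of a Poisson homomorphism from `P(A)` recovers an element of `Lie_{≥ 2}(Ω)` from its image in `P(A)`. -/
theorem component_lieMap
    (hτ : Finsupp.linearCombination A (KaehlerDifferential.D R A) ∘ₗ τ = LinearMap.id)
    [Module R (ModuleLie A (KaehlerDifferential R A))]
    [IsScalarTower R A (ModuleLie A (KaehlerDifferential R A))]
    (D : Derivation R A (ModuleLie A (KaehlerDifferential R A)))
    (hD : ∀ a, D a = ι A (KaehlerDifferential.D R A a))
    (ε : PoissonEnvelope R A →ₐ[R] A)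
    (δ : PoissonEnvelope R A →ₗ[R] ModuleLie A (KaehlerDifferential R A))
    (hof : ∀ a, ε (algebraMap A _ a) = a ∧ δ (algebraMap A _ a) = D a)
    (hlie : ∀ x y, ε ((poissonBracket R A).bracket x y) = 0 ∧
        δ ((poissonBracket R A).bracket x y) = ⁅δ x, δ y⁆)
    (hmul : ∀ x y, δ (x * y) = ε x • δ y + ε y • δ x)
    (y : LiePlus A (KaehlerDifferential R A)) :
    ε (lieMap τ (LiePlus.incl A _ y)) = 0 ∧
      δ (lieMap τ (LiePlus.incl A _ y)) = LiePlus.incl A _ y := by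
  -- The `A`-linear extension of `δ` to `A ⊗ P(A)`; it respects brackets because `δ` does.
  let Λ : ExtendedLie R A →ₗ⁅A⁆ ModuleLie A (KaehlerDifferential R A) :=
    { ExtendedLie.lift δ with
      map_lie' := fun {s t} => by
        change ExtendedLie.lift δ ⁅s, t⁆ = ⁅ExtendedLie.lift δ s, ExtendedLie.lift δ t⁆
        induction s using ExtendedLie.induction with
        | tmul c x =>
          induction t using ExtendedLie.induction with
          | tmul e y =>
            rw [ExtendedLie.lie_tmul, ExtendedLie.lift_tmul, ExtendedLie.lift_tmul,
              ExtendedLie.lift_tmul, (hlie x y).2, smul_lie, mul_smul]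
            congr 1
            exact (lie_smul e (δ x) (δ y)).symm
          | zero =>
            rw [lie_zero, map_zero]
            exact (lie_zero (L := ModuleLie A (KaehlerDifferential R A))
            (M := ModuleLie A (KaehlerDifferential R A)) _).symm
          | add t t' ht ht' =>
            rw [lie_add, map_add, map_add, ht, ht']
            exact (lie_add (L := ModuleLie A (KaehlerDifferential R A))
            (M := ModuleLie A (KaehlerDifferential R A)) _ _ _).symm
        | zero => rw [zero_lie, map_zero, zero_lie]
        | add s s' hs hs' => rw [add_lie, map_add, map_add, hs, hs', add_lie] }
  have hΛ (s) : Λ s = ExtendedLie.lift δ s := rfl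
  have hε {n : ℕ} {x : PoissonEnvelope R A} (hx : IsMonomial R n x) (hn : n ≠ 0) : ε x = 0 := by
    induction hx with
    | of a => exact absurd rfl hn
    | @mul m n x y _ _ ihx ihy =>
      rw [map_mul]
      by_cases hm : m = 0
      · rw [ihy (by omega), mul_zero]
      · rw [ihx hm, zero_mul]
    | bracket => exact (hlie _ _).1
  -- On a generator `ω` the composite is `∑ τ(ω)_b D b`, which is `ω` by the section property.
  have hcomp : Λ.comp (lieHom τ) = LieHom.id := ModuleLie.hom_ext fun ω => by
    have h := KaehlerDifferential.linearCombination_section hτ D ω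
    have h' : D.liftKaehlerDifferential = ι A := by
      refine Derivation.liftKaehlerDifferential_unique _ _ (Derivation.ext fun a => ?_)
      simp [hD]
    rw [LieHom.comp_apply, lieHom_ι, hΛ, Finsupp.apply_linearCombination]
    refine Eq.trans ?_ (h.trans congr($h' ω))
    congr 2
    ext a
    simp [(hof a).2]
  -- In `δ (c x) = c δ x + ε x D c` the last term vanishes in positive degree, so `δ` after
  -- multiplication agrees with `Λ` there. This is why only `Lie_{≥ 2}(Ω)` is recovered.
  have key {n : ℕ} (hn : n ≠ 0) {s : ExtendedLie R A} (hs : s ∈ extendedPart R A n) :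
      ε (scalarMul R A s) = 0 ∧ δ (scalarMul R A s) = Λ s := by
    induction hs using extendedPart_induction with
    | mem c x hx =>
      rw [scalarMul_tmul, Algebra.smul_def, map_mul, hmul, hε hx hn, zero_smul, add_zero,
        mul_zero, (hof c).1, hΛ, ExtendedLie.lift_tmul]
      exact ⟨rfl, rfl⟩
    | zero => simp
    | add s t _ _ hs ht =>
      rw [map_add, map_add, map_add, hs.1, ht.1, hs.2, ht.2, map_add, add_zero]
      exact ⟨rfl, rfl⟩
  induction y using DirectSum.induction_on with
  | zero => simp
  | of i y =>
    change ε (lieMap τ (LiePlus.incl A _ (DirectSum.lof A ℕ _ i y))) = 0 ∧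
      δ (lieMap τ (LiePlus.incl A _ (DirectSum.lof A ℕ _ i y))) =
        LiePlus.incl A _ (DirectSum.lof A ℕ _ i y)
    rw [LiePlus.incl_lof, lieMap_apply]
    have h := key (Nat.succ_ne_zero i) (lieHom_mem τ y.2)
    exact ⟨h.1, h.2.trans (LieHom.congr_fun hcomp _)⟩
  | add y y' hy hy' =>
    rw [map_add, map_add, map_add, map_add, hy.1, hy.2, hy'.1, hy'.2, add_zero]
    exact ⟨rfl, rfl⟩

theorem symmetricMap_injective [Algebra.FormallySmooth R A]
    (hτ : Finsupp.linearCombination A (KaehlerDifferential.D R A) ∘ₗ τ = LinearMap.id) :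
    Function.Injective (symmetricMap τ) := by
  let _ : Module R (ModuleLie A (KaehlerDifferential R A)) :=
    Module.compHom _ (algebraMap R A)
  have : IsScalarTower R A (ModuleLie A (KaehlerDifferential R A)) :=
    IsScalarTower.of_algebraMap_smul fun _ _ => rfl
  -- The universal derivation, with values in the generators of `Lie(Ω)`.
  let D : Derivation R A (ModuleLie A (KaehlerDifferential R A)) :=
    (ModuleLie.ι A).compDer (KaehlerDifferential.D R A)
  refine SymmetricAlgebra.injective_of_forall_exists (LiePlus.incl A (KaehlerDifferential R A))
    (LiePlus.retraction A (KaehlerDifferential R A)) (LiePlus.retraction_comp_incl A _) _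
    fun k hk => ?_
  obtain ⟨Φ, ε, δ, hΦ, hof, hlie, hmul⟩ := exists_ringHom_quotient D hk
  refine ⟨Φ, fun a => ?_, fun y => ?_⟩
  · obtain ⟨w, hw, hw'⟩ := hΦ (algebraMap A _ a)
    refine ⟨w, hw, ?_⟩
    have h1 := add_mem (Ideal.pow_le_self two_ne_zero hw')
      (SymmetricAlgebra.ι_mem_augIdeal (δ (algebraMap A _ a)))
    rwa [sub_add_cancel, (hof a).1] at h1
  · rw [symmetricMap_ι]
    obtain ⟨w, hw, hw'⟩ := hΦ (lieMap τ (LiePlus.incl A _ y))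
    obtain ⟨h1, h2⟩ := component_lieMap hτ D (fun _ => rfl) ε δ hof hlie hmul y
    rw [h1, h2, map_zero, sub_zero] at hw'
    exact ⟨w, hw, hw'⟩

end PoissonEnvelope

theorem theorem4p1p3 (A : Type*) [CommRing A] [Algebra ℂ A] [Algebra.Smooth ℂ A]
    [Algebra.FiniteType ℂ A] (d : ℕ) :
    Nonempty (PoissonEnvelope.degreePart ℂ A d ≃ₗ[A]
      QPart A (KaehlerDifferential ℂ A) d) := by
  have hs : Function.Surjective
      (Finsupp.linearCombination A (KaehlerDifferential.D ℂ A)) := by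
    rw [← LinearMap.range_eq_top, Finsupp.range_linearCombination]
    exact KaehlerDifferential.span_range_derivation ℂ A
  -- Smoothness makes `Ω` projective, so the identity of `Ω` lifts through the presentation.
  obtain ⟨τ, hτ⟩ := Module.projective_lifting_property _ LinearMap.id hs
  have hinj := PoissonEnvelope.symmetricMap_injective hτ
  exact ⟨((Submodule.equivMapOfInjective _ hinj _).trans
    (LinearEquiv.ofEq _ _ (PoissonEnvelope.map_symmetricMap hτ d))).symm⟩
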